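/- \textbf{Setting.} Let $G$ be the plane triangular grid, with directions $0,\dots,5$ in cyclic order (arithmetic modulo $6$). Contracted particles occupy a finite set $\mathcal P$ of nodes of $G$; $G_{\mathcal P}$ is the subgraph of $G$ induced by $\mathcal P$. A \emph{hole} is a bounded face of $G_{\mathcal P}$ with more than three vertices; $\mathcal P$ is \emph{simply connected} if $G_{\mathcal P}$ is connected and has no holes. Its diameter $d$ is the diameter of $G_{\mathcal P}$. An \emph{SP-tree} of $\mathcal P$ with root $r$ is a spanning tree of $G_{\mathcal P}$ in which the path from every particle to $r$ is a shortest path of $G_{\mathcal P}$. \textbf{Feather trees.} Let $r\in\mathcal P$, and let $N$ be a maximal independent set of the neighbours of $r$ in $G_{\mathcal P}$ that is chosen alternatingly, i.e. of any two adjacent neighbours of $r$ one belongs to $N$. The growth rule is as follows; particles grow only to occupied nodes. \begin{itemize} \item The root $r$ hands to its neighbour in direction $i$ the 3-cone $[i-1,i+1]$ if this neighbour is in $N$, and the 1-cone $[i]$ otherwise. \item A particle with a 3-cone $[i-1,i+1]$ (a \emph{shaft} particle) hands the 3-cone $[i-1,i+1]$ to its neighbour in direction $i$, and the 1-cones $[i-1]$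 and $[i+1]$ to its neighbours in directions $i-1$ and $i+1$. \item A particle with a 1-cone $[i]$ (a \emph{branch} particle) hands the 1-cone $[i]$ to its neighbour in direction $i$. If moreover the node in direction $i+2$ (respectively $i-2$) is empty and the node in direction $i+1$ (respectively $i-1$) is occupied, it starts a new shaft by handing the 3-cone $[i,i+2]$ (respectively $[i-2,i]$) to the latter. \end{itemize} A \emph{feather tree} of $\mathcal P$ with root $r$ and initial shafts $N$ is an SP-tree of $\mathcal P$ with root $r$ in which every particle other than $r$ carries a 3-cone or a 1-cone that it received from its parent by the growth rule. \textbf{Model.} All particles run the same algorithm with constant memory. They share neither orientation nor chirality, and address their neighbours only through six locally labelled ports. An asynchronous adversarial fair scheduler activates, at every time step, an arbitrary set of particles, such that each particle is activated infinitely often; if several particles write to the same particle in one step, an arbitrary one of them succeeds. A \emph{round} is a shortest time interval, starting at the end of the previous round, in which every particle is activated at least once. Initially only $r$ is in the tree; $r$ chooses $N$ by some fixed rule from its occupied ports. Whenever a particle of the tree is activated, it includes into the tree all its neighbours that are not yet in the tree and to which the growth rule lets it hand a cone; it becomes their parent and hands them these cones. \textbf{Lemma.} There is an absolute constant $C$ such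 that for every simply connected particle configuration $\mathcal P$ with diameter $d$, every particle $r\in\mathcal P$ and every choice of $N$ as above, there is a feather tree $F$ of $\mathcal P$ with root $r$ and initial shafts $N$ such that \begin{enumerate} \item every particle other than $r$ is reached in $F$ from exactly one direction, i.e. the growth rule lets exactly one of its neighbours hand a cone to it; \item for all orientations and chiralities of the particles, every rule by which the root chooses $N$, every fair activation sequence and every resolution of conflicts, when $C\cdot d$ rounds have ended the algorithm has grown exactly the tree $F$ (parents and cones), which does not change any more. In particular the tree is grown in $O(d)$ rounds and does not depend on the activation order. \end{enumerate} -/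

import Mathlib

/-! ### The triangular grid and particle configurations -/

/-- Nodes of the plane triangular grid, in axial coordinates. -/
abbrev Node : Type := ℤ × ℤ

/-- Global directions, in counter-clockwise order. Consecutive directions form an angle of `60°`. -/
abbrev Dir : Type := ZMod 6

/-- Local port labels of a contracted particle. -/
abbrev Port : Type := ZMod 6

/-- The unit vector of a direction. -/
def unit (g : Dir) : Node :=
  match g with
  | 0 => (1, 0)
  | 1 => (0, 1)
  | 2 => (-1, 1)
  | 3 => (-1, 0)
  | 4 => (0, -1)
  | 5 => (1, -1)

/-- The infinite triangular grid `G`. -/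
def triGrid : SimpleGraph Node :=
  SimpleGraph.fromRel (fun u v => ∃ g : Dir, v = u + unit g)

/-- `G_P`, the subgraph of the grid induced by the occupied nodes. -/
abbrev occupiedGraph (P : Finset Node) : SimpleGraph (P : Set Node) :=
  triGrid.induce (P : Set Node)

/-- The triangular faces of the grid: `(v, false)` has the corners `v, v + e₀, v + e₁`
and `(v, true)` has the corners `v, v + e₁, v + e₂`. -/
abbrev Tri : Type := Node × Bool

def corners (t : Tri) : Finset Node :=
  if t.2 then {t.1, t.1 + unit 1, t.1 + unit 2} else {t.1, t.1 + unit 0, t.1 + unit 1}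

/-- Two triangles of the grid are merged when they share an edge that is not an edge of `G_P`. -/
def mergeGraph (P : Finset Node) : SimpleGraph Tri where
  Adj s t := s ≠ t ∧ ∃ u w : Node, u ≠ w ∧ u ∈ corners s ∧ u ∈ corners t ∧
    w ∈ corners s ∧ w ∈ corners t ∧ ¬ (u ∈ P ∧ w ∈ P)
  symm := ⟨fun _ _ h => by
    obtain ⟨hne, u, w, h1, h2, h3, h4, h5, h6⟩ := h
    exact ⟨hne.symm, u, w, h1, h3, h2, h5, h4, h6⟩⟩
  loopless := ⟨fun _ h => h.1 rfl⟩

/-- A face of the plane graph `G_P`: a maximal union of grid triangles that are not separated by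
edges of `G_P`. -/
abbrev Face (P : Finset Node) : Type := (mergeGraph P).ConnectedComponent

/-- The vertices of `G_P` that are incident to a face. -/
def Face.vertices {P : Finset Node} (f : Face P) : Set Node :=
  {v | v ∈ P ∧ ∃ t ∈ f.supp, v ∈ corners t}

/-- A hole is an interior (that is, bounded) face with more than three vertices. -/
def Face.IsHole {P : Finset Node} (f : Face P) : Prop :=
  f.supp.Finite ∧ 3 < f.vertices.encard

/-- A configuration is simply connected if it is connected and has no holes. -/
def SimplyConnected (P : Finset Node) : Prop :=
  (occupiedGraph P).Connected ∧ ∀ f : Face P, ¬ f.IsHole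

/-! ### Feather trees -/

/-- The two kinds of cones. Particles with a 3-cone lie on shafts, those with a 1-cone on
branches. -/
inductive ConeKind : Type
  | three
  | one
  deriving DecidableEq

instance : Finite ConeKind :=
  Finite.of_injective (fun k : ConeKind => decide (k = .three)) (by
    intro a b h
    cases a <;> cases b <;> simp_all)

/-- The directions in the cone of the given kind around the direction `i`. -/
def cone (k : ConeKind) (i : ZMod 6) : Finset (ZMod 6) :=
  match k with
  | .three => {i - 1, i, i + 1}
  | .one => {i}

/-- `N` is an admissible choice of shaft directions at a root whose occupied neighbours lie in the
directions `occ`: a maximal independent set of the neighbours, taken alternatingly, which means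
that of any two adjacent neighbours one is chosen. -/
def IsShaftChoice (occ N : Finset (ZMod 6)) : Prop :=
  N ⊆ occ ∧
  (∀ i ∈ N, i + 1 ∉ N) ∧
  (∀ i ∈ occ, i ∈ N ∨ i + 1 ∈ N ∨ i - 1 ∈ N) ∧
  (∀ i ∈ occ, i + 1 ∈ occ → i ∈ N ∨ i + 1 ∈ N)

/-- The directions of the occupied neighbours of a node. -/
def occupiedDirs (P : Finset Node) (p : Node) : Finset Dir :=
  Finset.univ.filter (fun g => p + unit g ∈ P)

/-- A labelling of the particles other than the root: `F q = some (k, i)` means that the edge from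
the parent of `q` to `q` has direction `i`, and that `q` has the cone of kind `k` around `i`. -/
abbrev Labelling : Type := Node → Option (ConeKind × Dir)

/-- The growth rule: the particle `p` grows the tree to its neighbour in direction `g`
and hands a cone of kind `k` to it.
* The root hands 3-cones to the neighbours in `N` and 1-cones to the others.
* Any other particle grows in the directions of its cone: straight on with its own kind of cone,
  and to the sides (if it lies on a shaft) with 1-cones.
* A branch particle with direction `i` for which `i + 2` (or `i - 2`) is empty and `i + 1`
  (or `i - 1`) is occupied starts a new shaft in direction `i + 1` (or `i - 1`). -/
def Grows (P : Finset Node) (r : Node) (N : Finset Dir) (F : Labelling)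
    (p : Node) (g : Dir) (k : ConeKind) : Prop :=
  p ∈ P ∧ p + unit g ∈ P ∧
  ((p = r ∧ k = if g ∈ N then .three else .one) ∨
   (p ≠ r ∧ ∃ (κ : ConeKind) (i : Dir), F p = some (κ, i) ∧
     ((g ∈ cone κ i ∧ k = if g = i then κ else .one) ∨
      (κ = .one ∧ k = .three ∧
        ((g = i + 1 ∧ p + unit (i + 2) ∉ P) ∨ (g = i - 1 ∧ p + unit (i - 2) ∉ P))))))

/-- The graph on the particles whose edges join each particle to its parent. -/
def treeGraph (P : Finset Node) (F : Labelling) : SimpleGraph (P : Set Node) :=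
  SimpleGraph.fromRel (fun q p => ∃ (k : ConeKind) (i : Dir),
    F q.1 = some (k, i) ∧ p.1 + unit i = q.1)

/-- A shortest path tree of `P` with root `r`: a spanning tree of `G_P` in which the paths to the
root are shortest paths of `G_P`. -/
def IsSPTree (P : Finset Node) (r : (P : Set Node)) (T : SimpleGraph (P : Set Node)) : Prop :=
  T ≤ occupiedGraph P ∧ T.IsTree ∧ ∀ q, T.dist r q = (occupiedGraph P).dist r q

/-- A feather tree of `P` with root `r` and initial shafts in the directions `N`: an SP-tree in
which every particle other than the root has received its cone from its parent by the growth
rule. -/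
def IsFeatherTree (P : Finset Node) (r : (P : Set Node)) (N : Finset Dir) (F : Labelling) : Prop :=
  F r.1 = none ∧
  (∀ q ∈ P, q ≠ r.1 → ∃ (p : Node) (k : ConeKind) (i : Dir),
    F q = some (k, i) ∧ p + unit i = q ∧ Grows P r.1 N F p i k) ∧
  IsSPTree P r (treeGraph P F)

/-! ### The amoebot model, for contracted particles that do not move -/

/-- An amoebot algorithm: all particles run the same rule, with constant memory. When activated, a
particle sees its own memory and, for each of its ports, whether the adjacent node is occupied and
then the memory of the neighbour. It updates its own memory and sends messages over its ports.
`recv m j x` is the memory that results when a message `x` is written over the port `j` into the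
memory `m`. -/
structure AmoebotAlgorithm where
  Mem : Type
  Msg : Type
  finite_mem : Finite Mem
  finite_msg : Finite Msg
  act : Mem → (Port → Option Mem) → Mem × (Port → Option Msg)
  recv : Mem → Port → Msg → Mem

/-- The orientations and the chiralities of the particles, which are unknown to them. -/
structure Frame where
  offset : Node → ZMod 6
  mirrored : Node → Bool

/-- The global direction of port `k` of the particle at `p`. -/
def Frame.dir (fr : Frame) (p : Node) (k : Port) : Dir :=
  fr.offset p + if fr.mirrored p then -k else k

namespace AmoebotAlgorithm

variable (alg : AmoebotAlgorithm)

/-- What the particle at `p` sees over its ports. -/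
def view (P : Finset Node) (fr : Frame) (c : Node → alg.Mem) (p : Node) : Port → Option alg.Mem :=
  fun k => if p + unit (fr.dir p k) ∈ P then some (c (p + unit (fr.dir p k))) else none

/-- The activation of `p` sends the message `x` to the neighbour `q`, which receives it over its
port `j`. -/
def Sends (P : Finset Node) (fr : Frame) (c : Node → alg.Mem) (p q : Node) (j : Port)
    (x : alg.Msg) : Prop :=
  ∃ k : Port, p + unit (fr.dir p k) = q ∧ q + unit (fr.dir q j) = p ∧
    (alg.act (c p) (alg.view P fr c p)).2 k = some x

/-- One step of the system, in which the particles on the nodes in `A` are active simultaneously.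
If several messages arrive at a particle in the same step, an arbitrary one of them succeeds. -/
def Step (P : Finset Node) (fr : Frame) (A : Set Node) (c c' : Node → alg.Mem) : Prop :=
  ∀ q ∈ P, ∃ m : alg.Mem,
    (q ∈ A → m = (alg.act (c q) (alg.view P fr c q)).1) ∧ (q ∉ A → m = c q) ∧
    (((∀ p ∈ P, p ∈ A → ∀ j x, ¬ alg.Sends P fr c p q j x) ∧ c' q = m) ∨
      ∃ p ∈ P, p ∈ A ∧ ∃ j x, alg.Sends P fr c p q j x ∧ c' q = alg.recv m j x)

/-- `c` is an execution from the initial memories `c₀` under the activation sequence `A`. -/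
def IsExecution (P : Finset Node) (fr : Frame) (A : ℕ → Set Node) (c₀ : Node → alg.Mem)
    (c : ℕ → Node → alg.Mem) : Prop :=
  c 0 = c₀ ∧ ∀ t, alg.Step P fr (A t) (c t) (c (t + 1))

end AmoebotAlgorithm

/-- The scheduler is fair: at any time, any particle is activated at some later time. -/
def Fair (P : Finset Node) (A : ℕ → Set Node) : Prop :=
  ∀ p ∈ P, ∀ t, ∃ u ≥ t, p ∈ A u

/-- `T` is the time at which the `k`-th round ends. A round is a shortest time interval, starting at
the end of the round before, in which all particles are activated at least once. -/
def IsRoundEnd (P : Finset Node) (A : ℕ → Set Node) : ℕ → ℕ → Prop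
  | 0, T => T = 0
  | k + 1, T => ∃ S, IsRoundEnd P A k S ∧
      IsLeast {T' | S ≤ T' ∧ ∀ p ∈ P, ∃ u, S ≤ u ∧ u < T' ∧ p ∈ A u} T

/-! ### The algorithm that grows a feather tree -/

/-- A rule by which the root chooses its shafts, given its occupied ports. -/
structure ShaftRule where
  choose : Finset Port → Finset Port
  valid : ∀ occ, IsShaftChoice occ (choose occ)

instance : Nonempty ShaftRule := by
  have h : ∀ occ : Finset Port, IsShaftChoice occ (if occ = Finset.univ then {0, 2, 4} else
      occ.filter (fun i => i - 1 ∉ occ ∨ (i - 2 ∈ occ ∧ (i - 3 ∉ occ ∨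
        (i - 4 ∈ occ ∧ i - 5 ∉ occ))))) := by
    unfold IsShaftChoice
    decide +kernel
  exact ⟨⟨_, h⟩⟩

/-- The memory of a particle: not in the tree, root of the tree, or in the tree with a cone of
kind `k` and the parent at port `j`. -/
inductive FeatherMem : Type
  | idle
  | root
  | member (k : ConeKind) (j : Port)
  deriving DecidableEq

instance : Finite FeatherMem :=
  Finite.of_injective
    (fun m : FeatherMem => match m with
      | .idle => (none : Option (Option (ConeKind × Port)))
      | .root => some none
      | .member k j => some (some (k, j))) (by
    intro a b h
    cases a <;> cases b <;> simp_all)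

/-- The cone, if any, that an activated particle offers over its port `g`. Growth direction and
parent port are opposite. -/
def offer (χ : ShaftRule) (m : FeatherMem) (v : Port → Option FeatherMem) (g : Port) :
    Option ConeKind :=
  match m with
  | .idle => none
  | .root =>
      if g ∈ χ.choose (Finset.univ.filter (fun k => (v k).isSome)) then some .three else some .one
  | .member κ j =>
      if g ∈ cone κ (j + 3) then (if g = j + 3 then some κ else some .one)
      else if κ = .one ∧
          ((g = (j + 3) + 1 ∧ v ((j + 3) + 2) = none) ∨
            (g = (j + 3) - 1 ∧ v ((j + 3) - 2) = none)) then some .three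
      else none

/-- An activated particle of the tree includes all neighbours that it can grow to and that are not
part of the tree yet. The message to such a neighbour is the kind of the cone; as cones are
symmetric around the growth direction, the neighbour can recover its cone from the port over which
the message arrives. -/
def featherAlgorithm (χ : ShaftRule) : AmoebotAlgorithm where
  Mem := FeatherMem
  Msg := ConeKind
  finite_mem := inferInstance
  finite_msg := inferInstance
  act m v := (m, fun g => if v g = some .idle then offer χ m v g else none)
  recv m j k := if m = .idle then .member k j else m

/-- Initially the root is in the tree, and no other particle is. -/
def initialMem (r : Node) : Node → FeatherMem :=
  fun p => if p = r then .root else .idle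

/-- The labelling stored in the memories of the particles, in global directions. -/
def storedLabelling (fr : Frame) (c : Node → FeatherMem) : Labelling :=
  fun p => match c p with
    | .idle => none
    | .root => none
    | .member k j => some (k, fr.dir p j + 3)

/-- The shaft directions, in global terms, that the root `r` chooses by the rule `χ`. -/
def chosenShafts (P : Finset Node) (r : Node) (fr : Frame) (χ : ShaftRule) : Finset Dir :=
  (χ.choose (Finset.univ.filter (fun k => r + unit (fr.dir r k) ∈ P))).image (fr.dir r)

/-! ### Arithmetic of the grid directions -/

/-! Everything is governed by the distance `d` from the root. In a configuration without holes two
local facts hold at every particle: adjacent particles of equal distance have a common neighbour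
that is closer to the root (`TriangleAt`), and the closer neighbours of a particle are pairwise
adjacent (`IntervalAt`). Both are proved by one induction on the level
(`triangleAt_and_intervalAt`). To reach level `n + 1`, a path in the ball of radius `n` is closed up
through a new particle, or through a pair of adjacent ones. The ball with these particles added
still has no holes (`noHoles_ball_union`), so the closed path cannot wind around a node outside
(`IsGridChain.eq_zero`). This is a discrete Jordan curve argument: winding is measured by the parity
of the crossings with a horizontal ray.

By the two facts the growth rule always leads away from the root, and a particle with a 3-cone has
its parent as its only closer neighbour (`Grown.fits`). It follows by induction on the distance that
each particle `q` receives exactly one cone (`grown_existsUnique`). If `q` has a single closer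
neighbour, that neighbour always hands it a cone. If it has two, `u` and `v`, then `u`, `v`, `q` and
a common closer neighbour `w` of `u` and `v` form a rhombus, and the cone of `w` decides which of
`u` and `v` grows to `q`. When `w` is the root, the alternating choice of `N` decides.

Uniqueness makes the schedule irrelevant: whichever message succeeds, it carries the only cone that
the receiver can ever get (`grown_of_sends`). Every round completes at least one more level, so the
diameter bounds the number of rounds. -/

theorem unit_add_two (g : Dir) : unit (g + 2) = unit (g + 1) - unit g := by
  revert g; decide

theorem unit_add_three (g : Dir) : unit (g + 3) = -unit g := by
  revert g; decide

theorem unit_add_four (g : Dir) : unit (g + 4) = -unit (g + 1) := by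
  revert g; decide

theorem unit_add_five (g : Dir) : unit (g + 5) = unit g - unit (g + 1) := by
  revert g; decide

theorem unit_injective : Function.Injective unit := by
  unfold Function.Injective; decide

theorem unit_ne_zero (g : Dir) : unit g ≠ 0 := by
  revert g; decide

theorem add_unit_add_three (v : Node) (g : Dir) : v + unit g + unit (g + 3) = v := by
  rw [unit_add_three]; abel

theorem add_unit_three_add (v : Node) (g : Dir) : v + unit (g + 3) + unit g = v := by
  rw [unit_add_three]; abel

theorem add_unit_add_two (v : Node) (g : Dir) :
    v + unit g + unit (g + 2) = v + unit (g + 1) := by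
  rw [unit_add_two]; abel

theorem add_unit_add_four (v : Node) (g : Dir) :
    v + unit g + unit (g + 4) = v + unit (g + 5) := by
  rw [unit_add_four, unit_add_five]; abel

theorem dir_add_cancel (g : Dir) : g + 3 + 3 = g := by
  revert g; decide

/-! ### Triangles around a node -/

/-- The triangle with the corners `v`, `v + unit g` and `v + unit (g + 1)`. -/
def sector (v : Node) (g : Dir) : Tri :=
  match g with
  | 0 => (v, false)
  | 1 => (v, true)
  | 2 => (v - (1, 0), false)
  | 3 => (v - (0, 1), true)
  | 4 => (v - (0, 1), false)
  | 5 => (v + (1, -1), true)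

theorem sector_rotate (v : Node) (g : Dir) : sector (v + unit g) (g + 2) = sector v g := by
  obtain ⟨a, b⟩ := v
  fin_cases g <;> simp [sector, unit] <;> constructor

theorem sector_rotate' (v : Node) (g : Dir) :
    sector (v + unit (g + 1)) (g + 4) = sector v g := by
  rw [← sector_rotate v g, ← sector_rotate (v + unit g) (g + 2), add_unit_add_two]
  congr 1; ring

theorem mem_corners_sector (v : Node) (g : Dir) : v ∈ corners (sector v g) := by
  obtain ⟨a, b⟩ := v
  fin_cases g <;> simp [sector, unit, corners]

theorem add_mem_corners_sector (v : Node) (g : Dir) : v + unit g ∈ corners (sector v g) := by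
  rw [← sector_rotate v g]; exact mem_corners_sector _ _

theorem add_succ_mem_corners_sector (v : Node) (g : Dir) :
    v + unit (g + 1) ∈ corners (sector v g) := by
  rw [← sector_rotate' v g]; exact mem_corners_sector _ _

theorem exists_sector_of_mem_corners {v : Node} {t : Tri} (h : v ∈ corners t) :
    ∃ g, t = sector v g := by
  obtain ⟨w, b⟩ := t
  cases b
  · simp only [corners, Bool.false_eq_true, if_false, Finset.mem_insert,
      Finset.mem_singleton] at h
    rcases h with rfl | rfl | rfl
    · exact ⟨0, rfl⟩
    · exact ⟨2, by simp [sector, unit]⟩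
    · exact ⟨4, by simp [sector, unit]⟩
  · simp only [corners, if_true, Finset.mem_insert, Finset.mem_singleton] at h
    rcases h with rfl | rfl | rfl
    · exact ⟨1, rfl⟩
    · exact ⟨3, by simp [sector, unit]⟩
    · exact ⟨5, by simp [sector, unit, add_assoc]⟩

/-! ### Crossing parities -/

/-- The crossing of the edge between `p` and `p + unit g` for `g ∈ {0, 1, 2}` with the horizontal
ray that starts in the triangle `t` and points to the right. -/
def crossing (p : Node) (g : Dir) (t : Tri) : ZMod 2 :=
  if (g = 1 ∨ g = 2) ∧ p.2 = t.1.2 ∧ (t.1.1 < p.1 ∨ t.2 = true ∧ g = 1 ∧ t.1.1 = p.1) then 1 else 0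

/-- The indicator of the edge between `p` and `p + unit g` as a function of oriented edges. -/
def edgeIndicator (p : Node) (g : Dir) (v : Node) (h : Dir) : ZMod 2 :=
  if (v = p ∧ h = g) ∨ (v = p + unit g ∧ h = g + 3) then 1 else 0

/-- The half line to the right of the edge between `v` and `v + unit h`, if that is horizontal. -/
def rightOf (v : Node) (h : Dir) (w : Node) : ZMod 2 :=
  if w.2 = v.2 ∧ ((h = 0 ∧ v.1 < w.1) ∨ (h = 3 ∧ v.1 ≤ w.1)) then 1 else 0

theorem dir_cases (g : Dir) : g = 0 ∨ g = 1 ∨ g = 2 ∨ g = 3 ∨ g = 4 ∨ g = 5 := by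
  revert g; decide

/-- When the ray passes over a slanted edge, its count changes only if that edge is the given one.
Passing over a horizontal edge moves the ray to another row; it then gains or loses one crossing for
each end of the given edge that lies to the right. These corrections telescope along a path and
leave only its two ends. -/
theorem crossing_jump (p : Node) (g : Dir) (hg : g = 0 ∨ g = 1 ∨ g = 2) (v : Node) (h : Dir) :
    crossing p g (sector v h) + crossing p g (sector v (h + 5)) =
      edgeIndicator p g v h + (rightOf v h p + rightOf v h (p + unit g)) := by
  have two : (1 : ZMod 2) + 1 = 0 := rfl
  have e0 : (0 : Dir) + 5 = 5 := rfl
  have e1 : (1 : Dir) + 5 = 0 := rfl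
  have e2 : (2 : Dir) + 5 = 1 := rfl
  have e3 : (3 : Dir) + 5 = 2 := rfl
  have e4 : (4 : Dir) + 5 = 3 := rfl
  have e5 : (5 : Dir) + 5 = 4 := rfl
  obtain ⟨a, b⟩ := p
  obtain ⟨x, y⟩ := v
  rcases hg with rfl | rfl | rfl <;>
  rcases dir_cases h with rfl | rfl | rfl | rfl | rfl | rfl <;>
  simp +decide only [crossing, sector, edgeIndicator, rightOf, unit, e0, e1, e2, e3, e4, e5,
    Prod.mk_add_mk, Prod.mk_sub_mk, Prod.mk.injEq, true_and, and_true, false_and, and_false,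
    or_false, false_or, if_false] <;>
  split_ifs <;> first | rfl | (exfalso; omega)

/-! ### Chains modulo two -/

/-- The indicator of the half plane above the row of the triangle `t`. -/
def above (t : Tri) (w : Node) : ZMod 2 :=
  if t.1.2 < w.2 then 1 else 0

/-- `f` counts modulo two the crossings of rays to the right with a path from `p` to `q` that
traverses the edges according to `E`. -/
structure IsGridChain (p q : Node) (f : Tri → ZMod 2) (E : Node → Dir → ZMod 2) : Prop where
  jump : ∀ v h, f (sector v h) + f (sector v (h + 5)) =
    E v h + (rightOf v h p + rightOf v h q)
  far : ∃ M : ℤ, ∀ t : Tri, (M < t.1.1 ∨ M < t.1.2 ∨ t.1.2 < -M → f t = 0) ∧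
    (t.1.1 < -M → f t = above t p + above t q)

theorem zmod_two_add_self (a : ZMod 2) : a + a = 0 := by
  revert a; decide

theorem isGridChain_refl (p : Node) : IsGridChain p p (fun _ => 0) (fun _ _ => 0) where
  jump v h := by simp [zmod_two_add_self]
  far := ⟨0, fun t => by simp [zmod_two_add_self]⟩

theorem IsGridChain.trans {p q s : Node} {f f' : Tri → ZMod 2} {E E' : Node → Dir → ZMod 2}
    (h : IsGridChain p q f E) (h' : IsGridChain q s f' E') :
    IsGridChain p s (fun t => f t + f' t) (fun v g => E v g + E' v g) where
  jump v g := by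
    have h1 := h.jump v g
    have h2 := h'.jump v g
    have h3 := zmod_two_add_self (rightOf v g q)
    linear_combination h1 + h2 + h3
  far := by
    obtain ⟨M, hM⟩ := h.far
    obtain ⟨M', hM'⟩ := h'.far
    refine ⟨max M M', fun t => ⟨fun ht => ?_, fun ht => ?_⟩⟩
    · rw [(hM t).1 (by omega), (hM' t).1 (by omega), add_zero]
    · have h1 := (hM t).2 (by omega)
      have h2 := (hM' t).2 (by omega)
      have h3 := zmod_two_add_self (above t q)
      linear_combination h1 + h2 + h3

theorem IsGridChain.symm {p q : Node} {f : Tri → ZMod 2} {E : Node → Dir → ZMod 2}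
    (h : IsGridChain p q f E) : IsGridChain q p f E where
  jump v g := by rw [h.jump v g, add_comm (rightOf v g p)]
  far := by
    obtain ⟨M, hM⟩ := h.far
    exact ⟨M, fun t => ⟨(hM t).1, fun ht => by rw [(hM t).2 ht, add_comm]⟩⟩

theorem isGridChain_crossing (p : Node) (g : Dir) (hg : g = 0 ∨ g = 1 ∨ g = 2) :
    IsGridChain p (p + unit g) (crossing p g) (edgeIndicator p g) where
  jump := crossing_jump p g hg
  far := by
    refine ⟨max |p.1| |p.2|, fun ⟨⟨x, y⟩, b⟩ => ⟨fun ht => if_neg ?_, fun ht => ?_⟩⟩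
    · have h1 := abs_le.1 (le_max_left |p.1| |p.2|)
      have h2 := abs_le.1 (le_max_right |p.1| |p.2|)
      dsimp only at ht ⊢
      omega
    · have h1 := abs_le.1 (le_max_left |p.1| |p.2|)
      obtain ⟨a, b⟩ := p
      rcases hg with rfl | rfl | rfl
      · rw [show (a, b) + unit 0 = (a + 1, b) by simp [unit]]
        simp +decide [crossing, above, zmod_two_add_self]
      all_goals
        first
        | rw [show (a, b) + unit 1 = (a, b + 1) by simp [unit]]
        | rw [show (a, b) + unit 2 = (a + -1, b + 1) by simp [unit]]
        simp only [crossing, above] at ht h1 ⊢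
        split_ifs <;> first | rfl | (exfalso; simp +decide at *; omega)

theorem edgeIndicator_reverse (p : Node) (g : Dir) :
    edgeIndicator (p + unit g) (g + 3) = edgeIndicator p g := by
  funext v h
  simp only [edgeIndicator, add_unit_add_three, dir_add_cancel, or_comm]

theorem exists_isGridChain_step (p : Node) (g : Dir) :
    ∃ f, IsGridChain p (p + unit g) f (edgeIndicator p g) := by
  by_cases hg : g = 0 ∨ g = 1 ∨ g = 2
  · exact ⟨_, isGridChain_crossing p g hg⟩
  · have hg' : g + 3 = 0 ∨ g + 3 = 1 ∨ g + 3 = 2 := by revert g; decide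
    have h := (isGridChain_crossing (p + unit g) (g + 3) hg').symm
    rw [add_unit_add_three, edgeIndicator_reverse] at h
    exact ⟨_, h⟩

/-- Adjacency of the grid within a set of nodes. -/
def StepIn (B : Set Node) (u v : Node) : Prop :=
  u ∈ B ∧ v ∈ B ∧ ∃ g, v = u + unit g

theorem edgeIndicator_ne_zero {p : Node} {g : Dir} {v : Node} {h : Dir}
    (hE : edgeIndicator p g v h ≠ 0) :
    (v = p ∧ v + unit h = p + unit g) ∨ (v = p + unit g ∧ v + unit h = p) := by
  unfold edgeIndicator at hE
  split_ifs at hE with hc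
  · rcases hc with ⟨rfl, rfl⟩ | ⟨rfl, rfl⟩
    · exact Or.inl ⟨rfl, rfl⟩
    · exact Or.inr ⟨rfl, add_unit_add_three _ _⟩
  · exact absurd rfl hE

/-- The chains of the single steps are added up. An edge used twice cancels modulo two, so `E` is
supported on edges of the path, hence in `B`. -/
theorem exists_isGridChain {B : Set Node} {p q : Node} (h : Relation.ReflTransGen (StepIn B) p q) :
    ∃ f E, IsGridChain p q f E ∧ ∀ v g, E v g ≠ 0 → v ∈ B ∧ v + unit g ∈ B := by
  induction h with
  | refl => exact ⟨_, _, isGridChain_refl p, fun v g h => absurd rfl h⟩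
  | @tail b c _ hbc ih =>
    obtain ⟨f, E, hf, hE⟩ := ih
    obtain ⟨hb, hc, g, rfl⟩ := hbc
    obtain ⟨f', hf'⟩ := exists_isGridChain_step b g
    refine ⟨_, _, hf.trans hf', fun v h hne => ?_⟩
    by_cases h0 : E v h = 0
    · simp only [h0, zero_add] at hne
      rcases edgeIndicator_ne_zero hne with ⟨h1, h2⟩ | ⟨h1, h2⟩ <;> rw [h2, h1]
      exacts [⟨hb, hc⟩, ⟨hc, hb⟩]
    · exact hE v h h0

/-! ### Sets without holes -/

/-- Every component of the complement of `S` is infinite. -/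
def NoHoles (S : Set Node) : Prop :=
  ∀ K : Set Node, K.Finite → (∀ u ∈ K, u ∉ S) →
    (∀ u ∈ K, ∀ g, u + unit g ∉ S → u + unit g ∈ K) → K = ∅

theorem IsGridChain.finite_support {p : Node} {f : Tri → ZMod 2} {E : Node → Dir → ZMod 2}
    (hf : IsGridChain p p f E) : {t | f t ≠ 0}.Finite := by
  obtain ⟨M, hM⟩ := hf.far
  refine (((Set.finite_Icc (-M) M).prod (Set.finite_Icc (-M) M)).prod
    (Set.finite_univ (α := Bool))).subset fun t ht => ?_
  by_contra hc
  apply ht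
  simp only [Set.mem_prod, Set.mem_Icc, Set.mem_univ, and_true, not_and_or, not_le] at hc
  rcases hc with (hc | hc) | hc | hc
  · rw [(hM t).2 hc, zmod_two_add_self]
  · exact (hM t).1 (Or.inl hc)
  · exact (hM t).1 (Or.inr (Or.inr hc))
  · exact (hM t).1 (Or.inr (Or.inl hc))

/-- A closed chain in a set without holes does not wind around the nodes outside. -/
theorem IsGridChain.eq_zero {S : Set Node} (hS : NoHoles S) {p : Node} {f : Tri → ZMod 2}
    {E : Node → Dir → ZMod 2} (hf : IsGridChain p p f E)
    (hE : ∀ v g, E v g ≠ 0 → v ∈ S ∧ v + unit g ∈ S) (v : Node) (g : Dir)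
    (h : v ∉ S ∨ v + unit g ∉ S ∨ v + unit (g + 1) ∉ S) : f (sector v g) = 0 := by
  have around : ∀ u ∉ S, ∀ g, f (sector u g) = f (sector u 0) := by
    intro u hu
    -- No edge at a node outside `S` belongs to the chain, and the two end corrections cancel
    -- because the chain is closed.
    have step : ∀ g, f (sector u g) = f (sector u (g + 5)) := by
      intro g
      have h1 := hf.jump u g
      have h2 : E u g = 0 := by
        by_contra hne
        exact hu (hE u g hne).1
      rw [h2, zmod_two_add_self, add_zero] at h1
      have h3 := zmod_two_add_self (f (sector u (g + 5)))
      linear_combination h1 - h3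
    have e1 := step 1
    have e2 := step 2
    have e3 := step 3
    have e4 := step 4
    have e5 := step 5
    rw [show (1 : Dir) + 5 = 0 from rfl] at e1
    rw [show (2 : Dir) + 5 = 1 from rfl] at e2
    rw [show (3 : Dir) + 5 = 2 from rfl] at e3
    rw [show (4 : Dir) + 5 = 3 from rfl] at e4
    rw [show (5 : Dir) + 5 = 4 from rfl] at e5
    intro g
    rcases dir_cases g with rfl | rfl | rfl | rfl | rfl | rfl <;> simp only [e1, e2, e3, e4, e5]
  -- Adjacent nodes outside `S` share a triangle, so the nodes outside with nonzero parity are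
  -- closed under passing to neighbours outside. They are finitely many, since a closed chain
  -- vanishes far away.
  have hK : {u | u ∉ S ∧ f (sector u 0) ≠ 0} = ∅ := by
    refine hS _ ?_ (fun u hu => hu.1) ?_
    · refine Set.Finite.subset (hf.finite_support.image Prod.fst) fun u hu => ?_
      exact ⟨sector u 0, hu.2, rfl⟩
    · rintro u ⟨hu, hne⟩ g hg
      refine ⟨hg, ?_⟩
      rw [← around _ hg (g + 2), sector_rotate, around u hu]
      exact hne
  have zero : ∀ u ∉ S, ∀ g, f (sector u g) = 0 := by
    intro u hu g
    by_contra hne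
    rw [around u hu] at hne
    exact Set.eq_empty_iff_forall_notMem.1 hK u ⟨hu, hne⟩
  rcases h with h | h | h
  · exact zero v h g
  · rw [← sector_rotate]; exact zero _ h _
  · rw [← sector_rotate']; exact zero _ h _

/-! ### From bounded faces to finite components of the complement. -/

theorem mem_corners_sector_iff (u v : Node) (g : Dir) :
    v ∈ corners (sector u g) ↔ v = u ∨ v = u + unit g ∨ v = u + unit (g + 1) := by
  have e1 : (1 : Dir) + 1 = 2 := rfl
  have e2 : (2 : Dir) + 1 = 3 := rfl
  have e3 : (3 : Dir) + 1 = 4 := rfl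
  have e4 : (4 : Dir) + 1 = 5 := rfl
  have e5 : (5 : Dir) + 1 = 0 := rfl
  obtain ⟨a, b⟩ := u
  obtain ⟨x, y⟩ := v
  rcases dir_cases g with rfl | rfl | rfl | rfl | rfl | rfl <;>
  simp +decide only [sector, corners, unit, zero_add, e1, e2, e3, e4, e5, if_true, if_false,
    Finset.mem_insert, Finset.mem_singleton, Prod.mk_add_mk, Prod.mk_sub_mk, Prod.mk.injEq] <;>
  omega

/-- Nodes of the grid are ordered by rows, and within a row from left to right. -/
def rowOrder (v : Node) : ℤ ×ₗ ℤ := toLex (v.2, v.1)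

theorem rowOrder_le {u v : Node} :
    rowOrder u ≤ rowOrder v ↔ u.2 < v.2 ∨ u.2 = v.2 ∧ u.1 ≤ v.1 := by
  simp [rowOrder, Prod.Lex.toLex_le_toLex]

theorem mergeGraph_reachable_sector {P : Finset Node} {u : Node} (hu : u ∉ P) (g h : Dir) :
    (mergeGraph P).Reachable (sector u g) (sector u h) := by
  have step : ∀ g, (mergeGraph P).Reachable (sector u g) (sector u (g + 1)) := by
    intro g
    by_cases hne : sector u g = sector u (g + 1)
    · rw [hne]
    · refine SimpleGraph.Adj.reachable ⟨hne, u, u + unit (g + 1), ?_, mem_corners_sector _ _,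
        mem_corners_sector _ _, add_succ_mem_corners_sector _ _, add_mem_corners_sector _ _,
        fun hc => hu hc.1⟩
      intro hc
      exact unit_ne_zero _ (left_eq_add.1 hc)
  have from_zero : ∀ g, (mergeGraph P).Reachable (sector u 0) (sector u g) := by
    intro g
    have s0 := step 0
    have s1 := s0.trans (step 1)
    have s2 := s1.trans (step 2)
    have s3 := s2.trans (step 3)
    have s4 := s3.trans (step 4)
    rcases dir_cases g with rfl | rfl | rfl | rfl | rfl | rfl
    exacts [SimpleGraph.Reachable.refl _, s0, s1, s2, s3, s4]
  exact (from_zero g).symm.trans (from_zero h)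

/-- A finite nonempty `K` gives a hole: the face around a node of `K` consists of triangles with a
corner in `K`, so it is bounded, and it has at least four vertices. -/
theorem noHoles_of_simplyConnected {P : Finset Node} (hP : SimplyConnected P) :
    NoHoles (P : Set Node) := by
  intro K hfin hKP hclosed
  rw [Set.eq_empty_iff_forall_notMem]
  intro u₀ hu₀
  let f : Face P := (mergeGraph P).connectedComponentMk (sector u₀ 0)
  have hsupp : ∀ t ∈ f.supp, ∃ u ∈ K, u ∈ corners t := by
    intro t ht
    have hr : (mergeGraph P).Reachable (sector u₀ 0) t :=
      (SimpleGraph.ConnectedComponent.exact ht).symm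
    rw [SimpleGraph.reachable_iff_reflTransGen] at hr
    induction hr with
    | refl => exact ⟨u₀, hu₀, mem_corners_sector _ _⟩
    | @tail s t hs hst ih =>
      obtain ⟨u, huK, hus⟩ := ih (SimpleGraph.ConnectedComponent.sound
        (SimpleGraph.reachable_iff_reflTransGen _ _ |>.2 hs).symm)
      obtain ⟨-, v, w, -, hvs, hvt, hws, hwt, hvw⟩ := hst
      have key : ∀ v, v ∈ corners s → v ∉ P → v ∈ K := by
        intro v hv hvP
        obtain ⟨g, rfl⟩ := exists_sector_of_mem_corners hus
        rcases (mem_corners_sector_iff _ _ _).1 hv with rfl | rfl | rfl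
        · exact huK
        · exact hclosed _ huK _ hvP
        · exact hclosed _ huK _ hvP
      by_cases hv : v ∈ P
      · exact ⟨w, key w hws fun hw => hvw ⟨hv, hw⟩, hwt⟩
      · exact ⟨v, key v hvs hv, hvt⟩
  refine hP.2 f ⟨?_, ?_⟩
  · refine Set.Finite.subset ((hfin.prod (Set.finite_univ (α := Dir))).image
      fun x => sector x.1 x.2) fun t ht => ?_
    obtain ⟨u, hu, hut⟩ := hsupp t ht
    obtain ⟨g, rfl⟩ := exists_sector_of_mem_corners hut
    exact ⟨(u, g), ⟨hu, Set.mem_univ _⟩, rfl⟩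
  · let K' : Set Node := {u ∈ K | sector u 0 ∈ f.supp}
    have hmem : ∀ u ∈ K', ∀ g, sector u g ∈ f.supp := fun u hu g =>
      (SimpleGraph.ConnectedComponent.sound (mergeGraph_reachable_sector (hKP u hu.1) g 0)).trans
        hu.2
    have hfin' : K'.Finite := hfin.subset fun u hu => hu.1
    have hne : K'.Nonempty := ⟨u₀, hu₀, rfl⟩
    have hnext : ∀ u ∈ K', ∀ g, u + unit g ∉ P → u + unit g ∈ K' := by
      intro u hu g hg
      refine ⟨hclosed u hu.1 g hg, ?_⟩
      have h1 := hmem u hu g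
      rw [← sector_rotate] at h1
      exact (SimpleGraph.ConnectedComponent.sound (mergeGraph_reachable_sector hg 0 (g + 2))).trans
        h1
    -- The three neighbours of the last node `v` that come later in the row order, and the left
    -- neighbour of the first node `w`, are four distinct vertices of the face.
    obtain ⟨v, hv, hmax⟩ := Set.exists_max_image K' rowOrder hfin' hne
    obtain ⟨w, hw, hmin⟩ := Set.exists_min_image K' rowOrder hfin' hne
    have hin : ∀ u ∈ K', ∀ g, u + unit g ∉ K' → u + unit g ∈ f.vertices := by
      intro u hu g hg
      refine ⟨by_contra fun hc => hg (hnext u hu g hc), sector u g, hmem u hu g,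
        add_mem_corners_sector _ _⟩
    have hwv := hmax w hw
    rw [rowOrder_le] at hwv
    have e0 : ∀ x : Node, x + unit 0 = (x.1 + 1, x.2) := fun x => by ext <;> simp [unit]
    have e1 : ∀ x : Node, x + unit 1 = (x.1, x.2 + 1) := fun x => by ext <;> simp [unit]
    have e2 : ∀ x : Node, x + unit 2 = (x.1 - 1, x.2 + 1) := fun x => by
      ext <;> simp [unit]; ring
    have e3 : ∀ x : Node, x + unit 3 = (x.1 - 1, x.2) := fun x => by
      ext <;> simp [unit]; ring
    have h0 := hin v hv 0 fun hc => by
      have := hmax _ hc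
      rw [rowOrder_le, e0] at this
      dsimp only at this
      omega
    have h1 := hin v hv 1 fun hc => by
      have := hmax _ hc
      rw [rowOrder_le, e1] at this
      dsimp only at this
      omega
    have h2 := hin v hv 2 fun hc => by
      have := hmax _ hc
      rw [rowOrder_le, e2] at this
      dsimp only at this
      omega
    have h3 := hin w hw 3 fun hc => by
      have := hmin _ hc
      rw [rowOrder_le, e3] at this
      dsimp only at this
      omega
    rw [e0] at h0
    rw [e1] at h1
    rw [e2] at h2
    rw [e3] at h3
    have hsub : (({(v.1 + 1, v.2), (v.1, v.2 + 1), (v.1 - 1, v.2 + 1), (w.1 - 1, w.2)} :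
        Finset Node) : Set Node) ⊆ f.vertices := by
      intro x hx
      simp only [Finset.coe_insert, Finset.coe_singleton, Set.mem_insert_iff,
        Set.mem_singleton_iff] at hx
      rcases hx with rfl | rfl | rfl | rfl <;> assumption
    refine lt_of_lt_of_le ?_ (Set.encard_le_encard hsub)
    rw [Set.encard_coe_eq_coe_finsetCard, Finset.card_insert_of_notMem,
      Finset.card_insert_of_notMem, Finset.card_insert_of_notMem, Finset.card_singleton]
    · norm_num
    all_goals
      simp only [Finset.mem_insert, Finset.mem_singleton, Prod.mk.injEq]
      omega

/-! ### Distances in configurations without holes -/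

/-- The properties of the distance `d` from `r` in `G_P` as a function on nodes. -/
structure IsDistanceFrom (P : Finset Node) (r : Node) (d : Node → ℕ) : Prop where
  root_mem : r ∈ P
  root_eq : d r = 0
  lipschitz : ∀ q g, q ∈ P → q + unit g ∈ P → d (q + unit g) ≤ d q + 1
  exists_closer : ∀ q ∈ P, q ≠ r → ∃ g, q + unit g ∈ P ∧ d (q + unit g) + 1 = d q

/-- The neighbour of `q` in direction `g` is closer to the root. -/
def Closer (P : Finset Node) (d : Node → ℕ) (q : Node) (g : Dir) : Prop :=
  q + unit g ∈ P ∧ d (q + unit g) + 1 = d q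

/-- Two adjacent particles of the same level have a common neighbour on the level below. -/
def TriangleAt (P : Finset Node) (d : Node → ℕ) (q : Node) : Prop :=
  ∀ g, q + unit g ∈ P → d (q + unit g) = d q → Closer P d q (g + 1) ∨ Closer P d q (g + 5)

/-- Any two neighbours of `q` that are closer to the root are equal or adjacent. -/
def IntervalAt (P : Finset Node) (d : Node → ℕ) (q : Node) : Prop :=
  ∀ g h, Closer P d q g → Closer P d q h → h = g ∨ h = g + 1 ∨ g = h + 1

variable {P : Finset Node} {r : Node} {d : Node → ℕ}

theorem IsDistanceFrom.le_succ (hd : IsDistanceFrom P r d) {q : Node} {g : Dir} (hq : q ∈ P)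
    (hg : q + unit g ∈ P) : d q ≤ d (q + unit g) + 1 := by
  have h := hd.lipschitz (q + unit g) (g + 3) hg (by rwa [add_unit_add_three])
  rwa [add_unit_add_three] at h

theorem IsDistanceFrom.eq_root (hd : IsDistanceFrom P r d) {q : Node} (hq : q ∈ P)
    (h0 : d q = 0) : q = r := by
  by_contra hne
  obtain ⟨g, -, hg⟩ := hd.exists_closer q hq hne
  omega

/-- The middle node has two neighbours on its own level. In each of the two triangles on these edges
that contain `k`, the node `k` is excluded as closer neighbour, so both outer common neighbours are
closer. They are not adjacent, against `IntervalAt`. -/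
theorem not_three_consecutive {k : Node} {g : Dir} {n : ℕ} (hk : k ∈ P → d k + 1 ≠ n)
    (h0 : k + unit g ∈ P) (h2 : k + unit (g + 2) ∈ P)
    (d0 : d (k + unit g) = n) (d1 : d (k + unit (g + 1)) = n) (d2 : d (k + unit (g + 2)) = n)
    (hT : TriangleAt P d (k + unit (g + 1))) (hI : IntervalAt P d (k + unit (g + 1))) :
    False := by
  have back : ¬ Closer P d (k + unit (g + 1)) (g + 4) := by
    intro hc
    have e : k + unit (g + 1) + unit (g + 4) = k := by rw [unit_add_four]; abel
    rw [Closer, e, d1] at hc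
    exact hk hc.1 hc.2
  have e0 : k + unit (g + 1) + unit (g + 5) = k + unit g := by rw [unit_add_five]; abel
  have e2 : k + unit (g + 1) + unit (g + 3) = k + unit (g + 2) := by
    rw [unit_add_three, unit_add_two]; abel
  have c0 := hT (g + 5) (by rwa [e0]) (by rw [e0, d0, d1])
  have c2 := hT (g + 3) (by rwa [e2]) (by rw [e2, d2, d1])
  rw [(by decide : ∀ g : Dir, g + 5 + 1 = g) g, (by decide : ∀ g : Dir, g + 5 + 5 = g + 4) g] at c0
  rw [(by decide : ∀ g : Dir, g + 3 + 1 = g + 4) g, (by decide : ∀ g : Dir, g + 3 + 5 = g + 2) g] at c2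
  have hI' := hI g (g + 2) (c0.resolve_right back) (c2.resolve_left back)
  clear * - hI'
  revert g; decide

/-- An extreme node of a hole in the order `φ` sees three consecutive neighbours outside the hole.
They cannot all lie on level `n`, so `x` or `x'` lies above the maximum, and likewise below the
minimum. `hxx` rules this out when `x` and `x'` coincide or are consecutive in the order. -/
theorem noHoles_ball_union (hP : NoHoles (P : Set Node)) (hd : IsDistanceFrom P r d) (n : ℕ)
    (IH : ∀ q ∈ P, d q ≤ n → TriangleAt P d q ∧ IntervalAt P d q)
    {x x' : Node} (hx : x ∈ P) (hx' : x' ∈ P) (φ : Node → ℤ ×ₗ ℤ) (g : Dir)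
    (hφ : ∀ v, φ v < φ (v + unit g) ∧ φ v < φ (v + unit (g + 1)) ∧ φ v < φ (v + unit (g + 2)))
    (hxx : ∀ k k', φ k' ≤ φ k → φ x < φ k' ∨ φ x' < φ k' → φ k < φ x ∨ φ k < φ x' → False) :
    NoHoles ({q | q ∈ P ∧ d q ≤ n} ∪ {x, x'}) := by
  intro K hfin hKS hclosed
  have hSP : ∀ q ∈ ({q | q ∈ P ∧ d q ≤ n} ∪ {x, x'} : Set Node), q ∈ P := by
    rintro q (hq | rfl | rfl)
    exacts [hq.1, hx, hx']
  have hKP : ∀ u ∈ K, u ∈ P := by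
    intro u hu
    by_contra huP
    -- The unoccupied nodes of `K` would form a hole of `P` itself, so `K` consists of particles
    -- beyond level `n`.
    have h := hP (K \ P) (hfin.subset Set.sdiff_subset) (fun u hu => hu.2)
      (fun u hu g hg => ⟨hclosed u hu.1 g fun hc => hg (hSP _ hc), hg⟩)
    exact Set.eq_empty_iff_forall_notMem.1 h u ⟨hu, huP⟩
  by_contra hne
  rw [← ne_eq, ← Set.nonempty_iff_ne_empty] at hne
  have hlevel : ∀ u ∈ K, n < d u := fun u hu => by
    by_contra hc
    exact hKS u hu (Or.inl ⟨hKP u hu, not_lt.1 hc⟩)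
  have hnext : ∀ u ∈ K, ∀ g, u + unit g ∉ K →
      (u + unit g ∈ P ∧ d (u + unit g) = n) ∨ u + unit g = x ∨ u + unit g = x' := by
    intro u hu g hg
    have hS : u + unit g ∈ ({q | q ∈ P ∧ d q ≤ n} ∪ {x, x'} : Set Node) :=
      by_contra fun hc => hg (hclosed u hu g hc)
    rcases hS with hS | hS
    · have h1 := hd.le_succ (hKP u hu) hS.1
      have h2 := hlevel u hu
      have h3 : d (u + unit g) ≤ n := hS.2
      exact Or.inl ⟨hS.1, by omega⟩
    · exact Or.inr hS
  have corner : ∀ u ∈ K, ∀ g, u + unit g ∉ K → u + unit (g + 1) ∉ K → u + unit (g + 2) ∉ K →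
      ∃ h, (h = g ∨ h = g + 1 ∨ h = g + 2) ∧ (u + unit h = x ∨ u + unit h = x') := by
    intro u hu g h0 h1 h2
    rcases hnext u hu g h0 with c0 | c0
    swap
    · exact ⟨g, Or.inl rfl, c0⟩
    rcases hnext u hu (g + 1) h1 with c1 | c1
    swap
    · exact ⟨g + 1, Or.inr (Or.inl rfl), c1⟩
    rcases hnext u hu (g + 2) h2 with c2 | c2
    swap
    · exact ⟨g + 2, Or.inr (Or.inr rfl), c2⟩
    have h := IH _ c1.1 c1.2.le
    have hl := hlevel u hu
    exact (not_three_consecutive (fun _ => by omega) c0.1 c2.1 c0.2 c1.2 c2.2 h.1 h.2).elim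
  obtain ⟨k, hk, hmax⟩ := Set.exists_max_image K φ hfin hne
  obtain ⟨k', hk', hmin⟩ := Set.exists_min_image K φ hfin hne
  have hφ' : ∀ v, φ (v + unit (g + 3)) < φ v ∧ φ (v + unit (g + 3 + 1)) < φ v ∧
      φ (v + unit (g + 3 + 2)) < φ v := by
    intro v
    have e0 := (hφ (v + unit (g + 3))).1
    have e1 := (hφ (v + unit (g + 3 + 1))).2.1
    have e2 := (hφ (v + unit (g + 3 + 2))).2.2
    rw [add_unit_three_add] at e0
    rw [show g + 3 + 1 = (g + 1) + 3 by ring, add_unit_three_add] at e1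
    rw [show g + 3 + 2 = (g + 2) + 3 by ring, add_unit_three_add] at e2
    rw [show g + 3 + 1 = (g + 1) + 3 by ring, show g + 3 + 2 = (g + 2) + 3 by ring]
    exact ⟨e0, e1, e2⟩
  obtain ⟨h, hh, hu⟩ := corner k hk g (fun hc => absurd (hmax _ hc) (not_le.2 (hφ k).1))
    (fun hc => absurd (hmax _ hc) (not_le.2 (hφ k).2.1))
    (fun hc => absurd (hmax _ hc) (not_le.2 (hφ k).2.2))
  obtain ⟨h', hh', hu'⟩ := corner k' hk' (g + 3)
    (fun hc => absurd (hmin _ hc) (not_le.2 (hφ' k').1))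
    (fun hc => absurd (hmin _ hc) (not_le.2 (hφ' k').2.1))
    (fun hc => absurd (hmin _ hc) (not_le.2 (hφ' k').2.2))
  have up : φ k < φ (k + unit h) := by
    rcases hh with rfl | rfl | rfl
    exacts [(hφ k).1, (hφ k).2.1, (hφ k).2.2]
  have down : φ (k' + unit h') < φ k' := by
    rcases hh' with rfl | rfl | rfl
    exacts [(hφ' k').1, (hφ' k').2.1, (hφ' k').2.2]
  refine hxx k k' (hmax _ hk') ?_ ?_
  · rcases hu' with e | e <;> rw [e] at down
    exacts [Or.inl down, Or.inr down]
  · rcases hu with e | e <;> rw [e] at up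
    exacts [Or.inl up, Or.inr up]

/-- There is a total order of the nodes by lines of the grid that are parallel to a given edge,
in which the ends of the edge are consecutive. -/
theorem exists_lineOrder (x : Node) (h : Dir) : ∃ (φ : Node → ℤ ×ₗ ℤ) (g : Dir),
    (∀ v, φ v < φ (v + unit g) ∧ φ v < φ (v + unit (g + 1)) ∧ φ v < φ (v + unit (g + 2))) ∧
    ∀ k k', φ k' ≤ φ k → φ x < φ k' ∨ φ (x + unit h) < φ k' →
      φ k < φ x ∨ φ k < φ (x + unit h) → False := by
  have e0 : ∀ x : Node, x + unit 0 = (x.1 + 1, x.2) := fun x => by ext <;> simp [unit]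
  have e1 : ∀ x : Node, x + unit 1 = (x.1, x.2 + 1) := fun x => by ext <;> simp [unit]
  have e2 : ∀ x : Node, x + unit 2 = (x.1 - 1, x.2 + 1) := fun x => by
    ext <;> simp [unit]; ring
  have e3 : ∀ x : Node, x + unit 3 = (x.1 - 1, x.2) := fun x => by
    ext <;> simp [unit]; ring
  have e4 : ∀ x : Node, x + unit 4 = (x.1, x.2 - 1) := fun x => by
    ext <;> simp [unit]; ring
  have e5 : ∀ x : Node, x + unit 5 = (x.1 + 1, x.2 - 1) := fun x => by
    ext <;> simp [unit]; ring
  have a1 : (5 : Dir) + 1 = 0 := rfl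
  have a2 : (5 : Dir) + 2 = 1 := rfl
  rcases dir_cases h with rfl | rfl | rfl | rfl | rfl | rfl
  on_goal 1 => refine ⟨fun v => toLex (v.2, v.1), 0, ?_⟩
  on_goal 2 => refine ⟨fun v => toLex (v.1, v.2), 5, ?_⟩
  on_goal 3 => refine ⟨fun v => toLex (v.1 + v.2, v.2), 0, ?_⟩
  on_goal 4 => refine ⟨fun v => toLex (v.2, v.1), 0, ?_⟩
  on_goal 5 => refine ⟨fun v => toLex (v.1, v.2), 5, ?_⟩
  on_goal 6 => refine ⟨fun v => toLex (v.1 + v.2, v.2), 0, ?_⟩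
  all_goals
    simp only [zero_add, a1, a2, e0, e1, e2, e3, e4, e5, Prod.Lex.toLex_lt_toLex,
      Prod.Lex.toLex_le_toLex, true_and]
    constructor
    · intro v; omega
    · intro k k'; omega

/-! ### The induction on the level for triangles and intervals. -/

theorem StepIn.symm {B : Set Node} {u v : Node} (h : StepIn B u v) : StepIn B v u := by
  obtain ⟨hu, hv, g, rfl⟩ := h
  exact ⟨hv, hu, g + 3, (add_unit_add_three _ _).symm⟩

theorem IsDistanceFrom.ball_connected (hd : IsDistanceFrom P r d) {n : ℕ} {p q : Node}
    (hp : p ∈ P ∧ d p ≤ n) (hq : q ∈ P ∧ d q ≤ n) :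
    Relation.ReflTransGen (StepIn {q | q ∈ P ∧ d q ≤ n}) p q := by
  have to_root : ∀ m q, d q = m → q ∈ P ∧ d q ≤ n →
      Relation.ReflTransGen (StepIn {q | q ∈ P ∧ d q ≤ n}) q r := by
    intro m
    induction m with
    | zero =>
      intro q h0 hq
      rw [hd.eq_root hq.1 h0]
    | succ m ih =>
      intro q hm hq
      obtain ⟨g, hg, hdg⟩ := hd.exists_closer q hq.1 (by
        rintro rfl
        rw [hd.root_eq] at hm
        omega)
      have hg' : q + unit g ∈ P ∧ d (q + unit g) ≤ n := ⟨hg, by omega⟩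
      exact (ih _ (by omega) hg').head ⟨hq, hg', g, rfl⟩
  have hs : Std.Symm (StepIn {q | q ∈ P ∧ d q ≤ n}) := ⟨fun _ _ => StepIn.symm⟩
  exact (to_root _ p rfl hp).trans (Relation.ReflTransGen.stdSymm.symm _ _ (to_root _ q rfl hq))

theorem edgeIndicator_self (x : Node) (i g : Dir) :
    edgeIndicator x i x g = if g = i then 1 else 0 := by
  simp [edgeIndicator, unit_ne_zero]

/-- A path in the ball from one closer neighbour to the other is closed up through `x`. Around `x`
the parity changes exactly at the directions `i` and `j`, so it is nonzero in all sectors on one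
side. The corners of those sectors cannot lie outside, so all neighbours on that side are closer to
the root, and three in a row are impossible. -/
theorem intervalAt_succ (hP : NoHoles (P : Set Node)) (hd : IsDistanceFrom P r d) {n : ℕ}
    (IH : ∀ q ∈ P, d q ≤ n → TriangleAt P d q ∧ IntervalAt P d q)
    {x : Node} (hx : x ∈ P) (hdx : d x = n + 1) : IntervalAt P d x := by
  intro i j hi hj
  by_cases hij : j = i
  · exact Or.inl hij
  obtain ⟨φ, g₀, hφ, -⟩ := exists_lineOrder x 0
  -- Only one particle is added to the ball, so the pair of `noHoles_ball_union` degenerates to `x =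
  -- x'`.
  have hS := noHoles_ball_union hP hd n IH hx hx φ g₀ hφ (fun k k' h1 h2 h3 => by
    simp only [or_self] at h2 h3
    exact absurd (h1.trans_lt h3) h2.not_gt)
  have hxB : ¬ (x ∈ P ∧ d x ≤ n) := fun h => by omega
  obtain ⟨f₀, E₀, hf₀, hE₀⟩ := exists_isGridChain
    (hd.ball_connected (n := n) ⟨hi.1, by have := hi.2; omega⟩ ⟨hj.1, by have := hj.2; omega⟩)
  obtain ⟨f₁, hf₁⟩ := exists_isGridChain_step x i
  obtain ⟨f₂, hf₂⟩ := exists_isGridChain_step x j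
  obtain ⟨f, hf⟩ : ∃ f, IsGridChain x x f
      (fun v g => edgeIndicator x i v g + E₀ v g + edgeIndicator x j v g) :=
    ⟨_, (hf₁.trans hf₀).trans hf₂.symm⟩
  have hball : ∀ g, Closer P d x g → x + unit g ∈ ({q | q ∈ P ∧ d q ≤ n} ∪ {x, x} : Set Node) :=
    fun g hg => Or.inl ⟨hg.1, by have := hg.2; omega⟩
  have hself : x ∈ ({q | q ∈ P ∧ d q ≤ n} ∪ {x, x} : Set Node) := Or.inr (Or.inl rfl)
  have hedge : ∀ i, Closer P d x i → ∀ v g, edgeIndicator x i v g ≠ 0 →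
      v ∈ ({q | q ∈ P ∧ d q ≤ n} ∪ {x, x} : Set Node) ∧
      v + unit g ∈ ({q | q ∈ P ∧ d q ≤ n} ∪ {x, x} : Set Node) := by
    intro i hi v g h
    rcases edgeIndicator_ne_zero h with ⟨h1, h2⟩ | ⟨h1, h2⟩ <;> rw [h2, h1]
    exacts [⟨hself, hball i hi⟩, ⟨hball i hi, hself⟩]
  have hzero := hf.eq_zero hS (fun v g hne => by
    by_cases h1 : edgeIndicator x i v g = 0
    · by_cases h2 : edgeIndicator x j v g = 0
      · rw [h1, h2, zero_add, add_zero] at hne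
        exact ⟨Or.inl (hE₀ v g hne).1, Or.inl (hE₀ v g hne).2⟩
      · exact hedge j hj v g h2
    · exact hedge i hi v g h1)
  have hjump := hf.jump x
  have hE0 : ∀ g, E₀ x g = 0 := fun g => by
    by_contra hne
    exact hxB (hE₀ x g hne).1
  simp only [edgeIndicator_self, hE0, zmod_two_add_self, add_zero] at hjump
  have hin : ∀ g, x + unit g ∈ ({q | q ∈ P ∧ d q ≤ n} ∪ {x, x} : Set Node) → Closer P d x g := by
    rintro g (hg | hg)
    · have h1 := hd.le_succ hx hg.1
      have h2 : d (x + unit g) ≤ n := hg.2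
      exact ⟨hg.1, by omega⟩
    · simp [unit_ne_zero] at hg
  have hcl : ∀ g, f (sector x g) ≠ 0 → Closer P d x g ∧ Closer P d x (g + 1) := by
    intro g hg
    constructor <;> by_contra hc
    · exact hg (hzero x g (Or.inr (Or.inl fun h => hc (hin _ h))))
    · exact hg (hzero x g (Or.inr (Or.inr fun h => hc (hin _ h))))
  have three : ∀ g, Closer P d x g → Closer P d x (g + 1) → Closer P d x (g + 2) → False := by
    intro g h0 h1 h2
    have h := IH _ h1.1 (by have := h1.2; omega)
    exact not_three_consecutive (n := n) (fun _ => by omega) h0.1 h2.1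
      (by have := h0.2; omega) (by have := h1.2; omega) (by have := h2.2; omega) h.1 h.2
  have hi0 := hjump i
  rw [if_pos rfl, if_neg (Ne.symm hij), add_zero] at hi0
  -- Exactly one of the two sectors at the edge in direction `i` has nonzero parity. This selects
  -- the side of `i` on which three consecutive closer neighbours are found, unless `j` is the next
  -- direction there.
  by_cases h0 : f (sector x i) = 0
  · rw [h0, zero_add] at hi0
    have c5 := hcl (i + 5) (by rw [hi0]; decide)
    by_contra hcon
    have hj5 : i + 5 ≠ j := by
      rintro rfl
      exact hcon (Or.inr (Or.inr (by clear * -; revert i; decide)))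
    have h5 := hjump (i + 5)
    rw [if_neg (by clear * -; revert i; decide), if_neg hj5, hi0,
      (by decide : ∀ g : Dir, g + 5 + 5 = g + 4) i] at h5
    have c4 := hcl (i + 4) (by
      intro hc
      rw [hc] at h5
      exact absurd h5 (by decide))
    have e5 := (by decide : ∀ g : Dir, g + 4 + 1 = g + 5) i
    have e6 := (by decide : ∀ g : Dir, g + 4 + 2 = g) i
    exact three (i + 4) c4.1 (by rw [e5]; exact c5.1) (by rw [e6]; exact hi)
  · have c0 := hcl i h0
    by_contra hcon
    have hj1 : i + 1 ≠ j := by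
      rintro rfl
      exact hcon (Or.inr (Or.inl rfl))
    have h1 := hjump (i + 1)
    rw [if_neg (by clear * -; revert i; decide), if_neg hj1,
      (by decide : ∀ g : Dir, g + 1 + 5 = g) i] at h1
    have c1 := hcl (i + 1) (by
      intro hc
      rw [hc, zero_add, add_zero] at h1
      exact h0 h1)
    rw [(by decide : ∀ g : Dir, g + 1 + 1 = g + 2) i] at c1
    exact three i c0.1 c0.2 c1.2

/-- Paths to the ball from both ends of the edge, joined inside the ball, are closed up by the edge
itself. The closed chain uses this edge once, so the parity differs on its two sides. One of the two
triangles at the edge thus has nonzero parity, and its third corner must lie in the ball. -/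
theorem triangleAt_succ (hP : NoHoles (P : Set Node)) (hd : IsDistanceFrom P r d) {n : ℕ}
    (IH : ∀ q ∈ P, d q ≤ n → TriangleAt P d q ∧ IntervalAt P d q)
    {x : Node} (hx : x ∈ P) (hdx : d x = n + 1) : TriangleAt P d x := by
  intro h hx' hdx'
  by_contra hcon
  rw [not_or] at hcon
  have ne_root : ∀ y, d y = n + 1 → y ≠ r := by
    rintro y hy rfl
    rw [hd.root_eq] at hy
    omega
  obtain ⟨i, hi, hdi⟩ := hd.exists_closer x hx (ne_root x hdx)
  obtain ⟨j, hj, hdj⟩ := hd.exists_closer _ hx' (ne_root _ (by omega))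
  obtain ⟨φ, g₀, hφ, hxx⟩ := exists_lineOrder x h
  have hS := noHoles_ball_union hP hd n IH hx hx' φ g₀ hφ hxx
  set S : Set Node := {q | q ∈ P ∧ d q ≤ n} ∪ {x, x + unit h}
  obtain ⟨f₀, E₀, hf₀, hE₀⟩ := exists_isGridChain
    (hd.ball_connected (n := n) ⟨hi, by omega⟩ ⟨hj, by omega⟩)
  obtain ⟨f₁, hf₁⟩ := exists_isGridChain_step x i
  obtain ⟨f₂, hf₂⟩ := exists_isGridChain_step (x + unit h) j
  obtain ⟨f₃, hf₃⟩ := exists_isGridChain_step x h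
  have hf := ((hf₁.trans hf₀).trans hf₂.symm).trans hf₃.symm
  have m0 : x ∈ S := Or.inr (Or.inl rfl)
  have m1 : x + unit h ∈ S := Or.inr (Or.inr rfl)
  have m2 : x + unit i ∈ S := Or.inl ⟨hi, by omega⟩
  have m3 : x + unit h + unit j ∈ S := Or.inl ⟨hj, by omega⟩
  have hedge : ∀ p i, p ∈ S → p + unit i ∈ S → ∀ v g, edgeIndicator p i v g ≠ 0 →
      v ∈ S ∧ v + unit g ∈ S := by
    intro p i h0 h1 v g h
    rcases edgeIndicator_ne_zero h with ⟨h1, h2⟩ | ⟨h1, h2⟩ <;> rw [h2, h1]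
    exacts [⟨by assumption, by assumption⟩, ⟨by assumption, by assumption⟩]
  have hzero := hf.eq_zero hS (fun v g hne => by
    by_cases h1 : edgeIndicator x i v g = 0
    · by_cases h2 : edgeIndicator (x + unit h) j v g = 0
      · by_cases h3 : edgeIndicator x h v g = 0
        · rw [h1, h2, h3, zero_add, add_zero, add_zero] at hne
          exact ⟨Or.inl (hE₀ v g hne).1, Or.inl (hE₀ v g hne).2⟩
        · exact hedge _ _ m0 m1 v g h3
      · exact hedge _ _ m1 m3 v g h2
    · exact hedge _ _ m0 m2 v g h1)
  have hjump := hf.jump x h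
  have hE0 : E₀ x h = 0 := by
    by_contra hne
    have := (hE₀ x h hne).1.2
    omega
  have hE1 : edgeIndicator x i x h = 0 := by
    rw [edgeIndicator_self, if_neg]
    rintro rfl
    omega
  have hE2 : edgeIndicator (x + unit h) j x h = 0 := by
    by_contra hne
    rcases edgeIndicator_ne_zero hne with ⟨h1, -⟩ | ⟨h1, -⟩
    · exact unit_ne_zero h (left_eq_add.1 h1)
    · rw [← h1] at hdj
      omega
  have hE3 : edgeIndicator x h x h = 1 := by rw [edgeIndicator_self, if_pos rfl]
  have hin : ∀ g, g ≠ h → ¬ Closer P d x g → x + unit g ∉ S := by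
    rintro g hgh hg (hc | hc | hc)
    · have h1 := hd.le_succ hx hc.1
      have h2 : d (x + unit g) ≤ n := hc.2
      exact hg ⟨hc.1, by omega⟩
    · exact unit_ne_zero g (add_eq_left.1 hc)
    · exact hgh (unit_injective (add_left_cancel hc))
  rw [hzero x h (Or.inr (Or.inr (hin _ (by clear * -; revert h; decide) hcon.1))),
    hzero x (h + 5) (Or.inr (Or.inl (hin _ (by clear * -; revert h; decide) hcon.2))),
    hE0, hE1, hE2, hE3, zmod_two_add_self, zmod_two_add_self, zmod_two_add_self] at hjump
  exact absurd hjump (by decide)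

theorem triangleAt_and_intervalAt (hP : NoHoles (P : Set Node)) (hd : IsDistanceFrom P r d) :
    ∀ n, ∀ q ∈ P, d q ≤ n → TriangleAt P d q ∧ IntervalAt P d q := by
  intro n
  induction n with
  | zero =>
    intro q hq h0
    refine ⟨fun g hg hdg => ?_, fun g h hg _ => ?_⟩
    · have h1 := hd.eq_root hq (by omega)
      have h2 := hd.eq_root hg (by omega)
      rw [h1] at h2
      exact absurd (add_eq_left.1 h2) (unit_ne_zero g)
    · have := hg.2
      omega
  | succ n IH =>
    intro q hq hqn
    rcases Nat.lt_or_ge n (d q) with h | h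
    · exact ⟨triangleAt_succ hP hd IH hq (by omega), intervalAt_succ hP hd IH hq (by omega)⟩
    · exact IH q hq h

/-! ### The cones that reach a particle -/

/-- A particle `p` with the cone of kind `κ` around `i` may hand a cone of kind `k` to its
neighbour in direction `g`. -/
def Hands (P : Finset Node) (p : Node) (κ : ConeKind) (i g : Dir) (k : ConeKind) : Prop :=
  (g ∈ cone κ i ∧ k = if g = i then κ else .one) ∨
    (κ = .one ∧ k = .three ∧
      ((g = i + 1 ∧ p + unit (i + 2) ∉ P) ∨ (g = i - 1 ∧ p + unit (i - 2) ∉ P)))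

theorem dir_sub_one (i : Dir) : i - 1 = i + 5 := by revert i; decide

theorem dir_sub_two (i : Dir) : i - 2 = i + 4 := by revert i; decide

theorem hands_three {p : Node} {i g : Dir} {k : ConeKind} :
    Hands P p .three i g k ↔
      (g = i ∧ k = .three) ∨ ((g = i + 1 ∨ g = i + 5) ∧ k = .one) := by
  have e1 := (by decide : ∀ i : Dir, i + 1 ≠ i) i
  have e5 := (by decide : ∀ i : Dir, i + 5 ≠ i) i
  simp only [Hands, cone, dir_sub_one, Finset.mem_insert, Finset.mem_singleton, reduceCtorEq,
    false_and, or_false]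
  constructor
  · rintro ⟨rfl | rfl | rfl, h⟩ <;> simp_all
  · rintro (⟨rfl, h⟩ | ⟨rfl | rfl, h⟩) <;> simp_all

theorem hands_one {p : Node} {i g : Dir} {k : ConeKind} :
    Hands P p .one i g k ↔ (g = i ∧ k = .one) ∨
      (k = .three ∧ ((g = i + 1 ∧ p + unit (i + 2) ∉ P) ∨ (g = i + 5 ∧ p + unit (i + 4) ∉ P))) := by
  simp [Hands, cone, dir_sub_one, dir_sub_two]

theorem Hands.kind_unique {p : Node} {κ k k' : ConeKind} {i g : Dir} (h : Hands P p κ i g k)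
    (h' : Hands P p κ i g k') : k = k' := by
  have e1 := (by decide : ∀ i : Dir, i + 1 ≠ i) i
  have e5 := (by decide : ∀ i : Dir, i + 5 ≠ i) i
  cases κ
  · rw [hands_three] at h h'
    grind
  · rw [hands_one] at h h'
    grind

/-- `Grown P r N q k i`: the growth rule, started at `r`, lets `q` receive a cone of kind `k`
in direction `i`. -/
inductive Grown (P : Finset Node) (r : Node) (N : Finset Dir) : Node → ConeKind → Dir → Prop
  | root (g : Dir) : r + unit g ∈ P →
      Grown P r N (r + unit g) (if g ∈ N then .three else .one) g
  | step {p : Node} {κ k : ConeKind} {i g : Dir} : Grown P r N p κ i → p + unit g ∈ P →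
      Hands P p κ i g k → Grown P r N (p + unit g) k g

theorem Grown.mem {N : Finset Dir} {q : Node} {k : ConeKind} {i : Dir} (h : Grown P r N q k i) :
    q ∈ P := by
  cases h <;> assumption

theorem Grown.inversion {N : Finset Dir} {q : Node} {k : ConeKind} {g : Dir}
    (h : Grown P r N q k g) :
    (q + unit (g + 3) = r ∧ k = if g ∈ N then .three else .one) ∨
      ∃ κ i, Grown P r N (q + unit (g + 3)) κ i ∧ Hands P (q + unit (g + 3)) κ i g k := by
  cases h with
  | root _ _ => exact Or.inl ⟨add_unit_add_three _ _, rfl⟩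
  | step h1 h2 h3 =>
    rw [add_unit_add_three]
    exact Or.inr ⟨_, _, h1, h3⟩

/-- What the distances around a particle tell about the cone that it receives. -/
def Fits (P : Finset Node) (d : Node → ℕ) (q : Node) (k : ConeKind) (i : Dir) : Prop :=
  Closer P d q (i + 3) ∧ (k = .three → ∀ h, Closer P d q h → h = i + 3)

theorem two_steps {a b c : Dir} (h : unit a + unit b = unit c) (q : Node) :
    q + unit a + unit b = q + unit c := by
  rw [add_assoc, h]

theorem IntervalAt.cases {q : Node} {i h : Dir} (hI : IntervalAt P d q)
    (hi : Closer P d q (i + 3)) (hh : Closer P d q h) : h = i + 2 ∨ h = i + 3 ∨ h = i + 4 := by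
  have := hI _ _ hi hh
  clear * - this
  revert i h; decide

theorem IsDistanceFrom.eq_succ (hd : IsDistanceFrom P r d) {p : Node} (hp : p ∈ P)
    (hT : TriangleAt P d p) {g : Dir} (hg : p + unit g ∈ P) (h0 : ¬ Closer P d p g)
    (h1 : ¬ Closer P d p (g + 1)) (h5 : ¬ Closer P d p (g + 5)) :
    d (p + unit g) = d p + 1 := by
  have l1 := hd.lipschitz p g hp hg
  have l2 := hd.le_succ hp hg
  by_contra hne
  by_cases he : d (p + unit g) = d p
  · exact (hT g hg he).elim h1 h5
  · exact h0 ⟨hg, by omega⟩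

/-- By `TriangleAt`, a neighbour in direction `g` is farther away as soon as none of the directions
`g - 1`, `g`, `g + 1` leads closer. The closer directions lie around the parent. The only overlap
arises when a branch starts a shaft, and there the rule demands that the node in question be empty.
-/
theorem Fits.eq_succ (hd : IsDistanceFrom P r d) {p : Node} (hp : p ∈ P)
    (hT : TriangleAt P d p) (hI : IntervalAt P d p) {κ k : ConeKind} {i g : Dir}
    (hf : Fits P d p κ i) (hh : Hands P p κ i g k) (hg : p + unit g ∈ P) :
    d (p + unit g) = d p + 1 := by
  cases κ
  · have hc : ∀ h, h ≠ i + 3 → ¬ Closer P d p h := fun h hne hcl => hne (hf.2 rfl h hcl)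
    have hg' : g ≠ i + 3 ∧ g + 1 ≠ i + 3 ∧ g + 5 ≠ i + 3 := by
      have h1 : g = i ∨ g = i + 1 ∨ g = i + 5 := by
        rcases hands_three.1 hh with h | h | h <;> tauto
      clear * - h1
      revert i g; decide
    exact hd.eq_succ hp hT hg (hc _ hg'.1) (hc _ hg'.2.1) (hc _ hg'.2.2)
  · have hc : ∀ h, h ≠ i + 2 → h ≠ i + 3 → h ≠ i + 4 → ¬ Closer P d p h := fun h h2 h3 h4 hcl => by
      rcases hI.cases hf.1 hcl with h | h | h <;> contradiction
    rcases hands_one.1 hh with ⟨rfl, -⟩ | ⟨-, ⟨rfl, hn⟩ | ⟨rfl, hn⟩⟩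
    · refine hd.eq_succ hp hT hg (hc _ ?_ ?_ ?_) (hc _ ?_ ?_ ?_) (hc _ ?_ ?_ ?_) <;>
        (clear * -; revert g; decide)
    · refine hd.eq_succ hp hT hg (hc _ ?_ ?_ ?_) (fun h => hn ?_) (hc _ ?_ ?_ ?_)
      case refine_4 =>
        have := h.1
        rwa [(by decide : ∀ i : Dir, i + 1 + 1 = i + 2) i] at this
      all_goals clear * -; revert i; decide
    · refine hd.eq_succ hp hT hg (hc _ ?_ ?_ ?_) (hc _ ?_ ?_ ?_) (fun h => hn ?_)
      case refine_7 =>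
        have := h.1
        rwa [(by decide : ∀ i : Dir, i + 5 + 5 = i + 4) i] at this
      all_goals clear * -; revert i; decide

/-- By `IntervalAt`, a second closer neighbour would be adjacent to the parent. -/
theorem Grown.fits (hd : IsDistanceFrom P r d)
    (hTI : ∀ q ∈ P, TriangleAt P d q ∧ IntervalAt P d q) {N : Finset Dir} {q : Node}
    {k : ConeKind} {i : Dir} (h : Grown P r N q k i) : Fits P d q k i := by
  induction h with
  | root g hg =>
    have h1 : d (r + unit g) = 1 := by
      have l1 := hd.lipschitz r g hd.root_mem hg
      have l2 : d (r + unit g) ≠ 0 := fun h0 =>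
        unit_ne_zero g (add_eq_left.1 (hd.eq_root hg h0))
      rw [hd.root_eq] at l1
      omega
    refine ⟨⟨?_, ?_⟩, fun _ h hc => ?_⟩
    · rw [add_unit_add_three]; exact hd.root_mem
    · rw [add_unit_add_three, hd.root_eq, h1]
    · have h2 := hd.eq_root hc.1 (by have := hc.2; omega)
      rw [add_assoc, add_eq_left, add_comm] at h2
      exact unit_injective ((eq_neg_of_add_eq_zero_left h2).trans (unit_add_three g).symm)
  | @step p κ k i g hp hg hh ih =>
    have hpP := hp.mem
    have hs := ih.eq_succ hd hpP (hTI p hpP).1 (hTI p hpP).2 hh hg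
    have hc : Closer P d (p + unit g) (g + 3) := by
      rw [Closer, add_unit_add_three]
      exact ⟨hpP, hs.symm⟩
    refine ⟨hc, fun hk h hcl => ?_⟩
    subst hk
    -- A node to which `p` may also hand a cone is on the level of the new particle or empty. For a
    -- 3-cone, each of the two rival nodes is of this kind or is the node required to be empty.
    have far : ∀ (g' : Dir) (k' : ConeKind), Hands P p κ i g' k' →
        d (p + unit g') + 1 ≠ d (p + unit g) ∨ p + unit g' ∉ P := fun g' k' hh' => by
      by_cases hg' : p + unit g' ∈ P
      · have := ih.eq_succ hd hpP (hTI p hpP).1 (hTI p hpP).2 hh' hg'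
        exact Or.inl (by omega)
      · exact Or.inr hg'
    have key : (p + unit (g + 1) ∉ P ∨ d (p + unit (g + 1)) + 1 ≠ d (p + unit g)) ∧
        (p + unit (g + 5) ∉ P ∨ d (p + unit (g + 5)) + 1 ≠ d (p + unit g)) := by
      cases κ
      · rcases hands_three.1 hh with ⟨rfl, -⟩ | ⟨-, hk⟩
        · exact ⟨(far (g + 1) .one (hands_three.2 (by tauto))).symm,
            (far (g + 5) .one (hands_three.2 (by tauto))).symm⟩
        · cases hk
      · rcases hands_one.1 hh with ⟨-, hk⟩ | ⟨-, ⟨rfl, hn⟩ | ⟨rfl, hn⟩⟩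
        · cases hk
        · rw [(by decide : ∀ i : Dir, i + 1 + 1 = i + 2) i,
            (by decide : ∀ i : Dir, i + 1 + 5 = i) i]
          exact ⟨Or.inl hn, (far i .one (hands_one.2 (by tauto))).symm⟩
        · rw [(by decide : ∀ i : Dir, i + 5 + 1 = i) i,
            (by decide : ∀ i : Dir, i + 5 + 5 = i + 4) i]
          exact ⟨(far i .one (hands_one.2 (by tauto))).symm, Or.inl hn⟩
    rcases (hTI _ hg).2.cases hc hcl with rfl | rfl | rfl
    · rw [Closer, add_unit_add_two] at hcl
      tauto
    · rfl
    · rw [Closer, add_unit_add_four] at hcl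
      tauto

theorem Grown.of_hands {N : Finset Dir} {p q : Node} {κ k : ConeKind} {i g : Dir}
    (h : Grown P r N p κ i) (hq : q ∈ P) (e : p + unit g = q) (hh : Hands P p κ i g k) :
    Grown P r N q k g := by
  subst e
  exact h.step hq hh

/-- Among the two neighbours `u` and `v` of `q` that are closer to the root, only `v` hands a cone
to `q`. -/
theorem grown_only_left {N : Finset Dir} {u v q : Node} {i : Dir} {κ : ConeKind} {j : Dir}
    (hq : q ∈ P) (hur : u ≠ r) (hvP : v ∈ P) (hv : v + unit (i + 1) = q)
    (huv : u + unit (i + 5) = v) (huq : q + unit (i + 3) = u)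
    (uniq : ∀ k g, Grown P r N u k g → k = .one ∧ g = i + 1)
    (hgv : Grown P r N v κ j) (hκ : (κ = .three ∧ j = i) ∨ (κ = .one ∧ j = i + 1))
    (hdir : ∀ k g, Grown P r N q k g → g = i ∨ g = i + 1) :
    ∃ g, (∃ k, Grown P r N q k g) ∧ ∀ k' g', Grown P r N q k' g' → g' = g := by
  refine ⟨i + 1, ⟨.one, ?_⟩, fun k' g' hg => ?_⟩
  · rcases hκ with ⟨rfl, rfl⟩ | ⟨rfl, rfl⟩
    · exact hgv.of_hands hq hv (hands_three.2 (by tauto))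
    · exact hgv.of_hands hq hv (hands_one.2 (by tauto))
  · rcases hdir _ _ hg with rfl | rfl
    · rcases hg.inversion with ⟨h1, -⟩ | ⟨κ', i', h1, h2⟩ <;> rw [huq] at h1
      · exact absurd h1 hur
      · obtain ⟨rfl, rfl⟩ := uniq _ _ h1
        rw [huq] at h2
        rcases hands_one.1 h2 with ⟨h3, -⟩ | ⟨-, ⟨h3, -⟩ | ⟨-, h3⟩⟩
        · exact h3
        · exact absurd h3 (by clear * -; revert g'; decide)
        · rw [(by decide : ∀ i : Dir, i + 1 + 4 = i + 5) g', huv] at h3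
          exact absurd hvP h3
    · rfl

/-- Among the two neighbours `u` and `v` of `q` that are closer to the root, only `u` hands a cone
to `q`. -/
theorem grown_only_right {N : Finset Dir} {u v q : Node} {i : Dir} {κ : ConeKind} {j : Dir}
    (hq : q ∈ P) (hvr : v ≠ r) (huP : u ∈ P) (hu : u + unit i = q)
    (hvu : v + unit (i + 2) = u) (hvq : q + unit (i + 4) = v)
    (uniq : ∀ k g, Grown P r N v k g → k = .one ∧ g = i)
    (hgu : Grown P r N u κ j) (hκ : (κ = .three ∧ j = i + 1) ∨ (κ = .one ∧ j = i))
    (hdir : ∀ k g, Grown P r N q k g → g = i ∨ g = i + 1) :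
    ∃ g, (∃ k, Grown P r N q k g) ∧ ∀ k' g', Grown P r N q k' g' → g' = g := by
  refine ⟨i, ⟨.one, ?_⟩, fun k' g' hg => ?_⟩
  · rcases hκ with ⟨rfl, rfl⟩ | ⟨rfl, rfl⟩
    · refine hgu.of_hands hq hu (hands_three.2 (Or.inr ⟨Or.inr ?_, rfl⟩))
      clear * -; revert i; decide
    · exact hgu.of_hands hq hu (hands_one.2 (by tauto))
  · rcases hdir _ _ hg with rfl | rfl
    · rfl
    · have hvq' : q + unit (i + 1 + 3) = v := by
        rw [(by decide : ∀ i : Dir, i + 1 + 3 = i + 4) i, hvq]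
      rcases hg.inversion with ⟨h1, -⟩ | ⟨κ', i', h1, h2⟩ <;> rw [hvq'] at h1
      · exact absurd h1 hvr
      · obtain ⟨rfl, rfl⟩ := uniq _ _ h1
        rw [hvq'] at h2
        rcases hands_one.1 h2 with ⟨h3, -⟩ | ⟨-, ⟨-, h3⟩ | ⟨h3, -⟩⟩
        · exact h3
        · rw [hvu] at h3
          exact absurd huP h3
        · exact absurd h3 (by clear * -; revert i'; decide)

/-- Every particle at distance less than `n` from the root receives exactly one cone. -/
def UniqueBelow (P : Finset Node) (r : Node) (N : Finset Dir) (d : Node → ℕ) (n : ℕ) : Prop :=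
  ∀ p ∈ P, p ≠ r → d p < n →
    ∃ κ i, Grown P r N p κ i ∧ ∀ κ' i', Grown P r N p κ' i' → κ' = κ ∧ i' = i

/-- Cones come only from closer neighbours, so only existence is at stake: the cone of the single
closer neighbour `p` points within 60° of `q`. -/
theorem exists_unique_dir_of_single (hd : IsDistanceFrom P r d)
    (hTI : ∀ q ∈ P, TriangleAt P d q ∧ IntervalAt P d q) {N : Finset Dir} {q : Node} (hq : q ∈ P)
    (IH : UniqueBelow P r N d (d q)) {i : Dir} (hc : Closer P d q (i + 3))
    (hsingle : ∀ h, Closer P d q h → h = i + 3) :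
    ∃ g, (∃ k, Grown P r N q k g) ∧ ∀ k' g', Grown P r N q k' g' → g' = g := by
  suffices h : ∃ k, Grown P r N q k i by
    refine ⟨i, h, fun k' g' hg => ?_⟩
    have := hsingle _ (hg.fits hd hTI).1
    exact add_right_cancel this
  obtain ⟨p, hp⟩ : ∃ p, p = q + unit (i + 3) := ⟨_, rfl⟩
  have hpq : p + unit i = q := by rw [hp, add_unit_three_add]
  have hpP : p ∈ P := hp ▸ hc.1
  have hdp : d p + 1 = d q := hp ▸ hc.2
  by_cases hpr : p = r
  · subst hpr
    exact ⟨_, hpq ▸ Grown.root i (by rwa [hpq])⟩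
  obtain ⟨κ, j, hg, -⟩ := IH p hpP hpr (by omega)
  have hf := hg.fits hd hTI
  have e1 : p + unit (i + 1) = q + unit (i + 2) := by
    rw [← hpq, add_unit_add_two]
  have e5 : p + unit (i + 5) = q + unit (i + 4) := by
    rw [← hpq, add_unit_add_four]
  have hno : ∀ h, Closer P d p h → h ≠ i ∧ h ≠ i + 1 ∧ h ≠ i + 5 := by
    intro h hh
    refine ⟨?_, ?_, ?_⟩ <;> rintro rfl
    · have := hh.2
      rw [hpq] at this
      omega
    · have h1 := hh.1
      have h2 := hh.2
      rw [e1] at h1 h2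
      have := hd.le_succ hq h1
      omega
    · have h1 := hh.1
      have h2 := hh.2
      rw [e5] at h1 h2
      have := hd.le_succ hq h1
      omega
  have hclose : ∀ a b c : Dir, p + unit a ∈ P → d (p + unit a) + 1 = d p →
      p + unit a + unit b = q + unit c → q + unit c ∈ P → Closer P d q c := by
    intro a b c h1 h2 h3 h4
    have l1 := hd.lipschitz _ b h1 (by rwa [h3])
    have l2 := hd.le_succ hq h4
    rw [h3] at l1
    exact ⟨h4, by omega⟩
  have hj := hno _ hf.1
  have hj' : j = i ∨ j = i + 1 ∨ j = i + 5 := by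
    clear * - hj
    revert i j; decide
  cases κ
  · rcases hj' with rfl | rfl | rfl
    · exact ⟨_, hg.of_hands hq hpq (hands_three.2 (Or.inl ⟨rfl, rfl⟩))⟩
    · refine ⟨_, hg.of_hands hq hpq (hands_three.2 (Or.inr ⟨Or.inr ?_, rfl⟩))⟩
      clear * -; revert i; decide
    · refine ⟨_, hg.of_hands hq hpq (hands_three.2 (Or.inr ⟨Or.inl ?_, rfl⟩))⟩
      clear * -; revert i; decide
  · rcases hj' with rfl | rfl | rfl
    · exact ⟨_, hg.of_hands hq hpq (hands_one.2 (Or.inl ⟨rfl, rfl⟩))⟩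
    -- The branch at `p` has to turn towards `q`. The node that must be empty is adjacent to the
    -- parent of `p` and to `q`; if occupied, it would be a second closer neighbour of `q`.
    · refine ⟨_, hg.of_hands hq hpq (hands_one.2 (Or.inr ⟨rfl, Or.inr ⟨?_, fun hx => ?_⟩⟩))⟩
      · clear * -; revert i; decide
      · rw [(by decide : ∀ i : Dir, i + 1 + 4 = i + 5) i, e5] at hx
        have := hsingle _ (hclose (i + 1 + 3) i (i + 4) hf.1.1 hf.1.2 (by
          rw [← e5]; exact two_steps (by clear * -; revert i; decide) p) hx)
        clear * - this
        revert i; decide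
    · refine ⟨_, hg.of_hands hq hpq (hands_one.2 (Or.inr ⟨rfl, Or.inl ⟨?_, fun hx => ?_⟩⟩))⟩
      · clear * -; revert i; decide
      · rw [(by decide : ∀ i : Dir, i + 5 + 2 = i + 1) i, e1] at hx
        have := hsingle _ (hclose (i + 5 + 3) i (i + 2) hf.1.1 hf.1.2 (by
          rw [← e1]; exact two_steps (by clear * -; revert i; decide) p) hx)
        clear * - this
        revert i; decide

/-- In the rhombus `w`, `u`, `v`, `q`, one of `u` and `v` is on a branch parallel to the side that
leads past `q`. It could reach `q` only by starting a shaft, which the occupied other node prevents.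
The other one does hand a cone to `q`. The cases `left` and `right` are mirror images. -/
theorem exists_unique_dir_of_double (hd : IsDistanceFrom P r d)
    (hTI : ∀ q ∈ P, TriangleAt P d q ∧ IntervalAt P d q) {N : Finset Dir}
    (hN : IsShaftChoice (occupiedDirs P r) N) {q : Node} (hq : q ∈ P)
    (IH : UniqueBelow P r N d (d q)) {i : Dir} (hc3 : Closer P d q (i + 3))
    (hc4 : Closer P d q (i + 4)) :
    ∃ g, (∃ k, Grown P r N q k g) ∧ ∀ k' g', Grown P r N q k' g' → g' = g := by
  have hdir : ∀ k g, Grown P r N q k g → g = i ∨ g = i + 1 := by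
    intro k g hg
    have h1 := (hTI q hq).2.cases hc3 (hg.fits hd hTI).1
    have h2 := (hTI q hq).2 _ _ hc4 (hg.fits hd hTI).1
    clear * - h1 h2
    revert i g; decide
  obtain ⟨u, hu⟩ : ∃ u, u = q + unit (i + 3) := ⟨_, rfl⟩
  obtain ⟨v, hv⟩ : ∃ v, v = q + unit (i + 4) := ⟨_, rfl⟩
  have huq : u + unit i = q := by rw [hu, add_unit_three_add]
  have hvq : v + unit (i + 1) = q := by
    rw [hv, unit_add_four]; abel
  have huv : u + unit (i + 5) = v := by
    rw [hu, hv]; exact two_steps (by clear * -; revert i; decide) q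
  have hvu : v + unit (i + 2) = u := by
    rw [hu, hv]; exact two_steps (by clear * -; revert i; decide) q
  have huP : u ∈ P := hu ▸ hc3.1
  have hvP : v ∈ P := hv ▸ hc4.1
  have hdu : d u + 1 = d q := hu ▸ hc3.2
  have hdv : d v + 1 = d q := hv ▸ hc4.2
  have hw : Closer P d u (i + 4) := by
    have h := (hTI u huP).1 (i + 5) (by rwa [huv]) (by rw [huv]; omega)
    rw [(by decide : ∀ i : Dir, i + 5 + 1 = i) i,
      (by decide : ∀ i : Dir, i + 5 + 5 = i + 4) i] at h
    refine h.resolve_left fun hc => ?_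
    have := hc.2
    rw [huq] at this
    omega
  obtain ⟨w, hwdef⟩ : ∃ w, w = u + unit (i + 4) := ⟨_, rfl⟩
  have hwP : w ∈ P := hwdef ▸ hw.1
  have hdw : d w + 1 = d u := hwdef ▸ hw.2
  have hwu : w + unit (i + 1) = u := by rw [hwdef, unit_add_four]; abel
  have hwv : w + unit i = v := by
    rw [← huv, ← hwu, unit_add_five]; abel
  have hvw : v + unit (i + 3) = w := by rw [← hwv, add_unit_add_three]
  have hur : u ≠ r := by
    rintro rfl
    have := hd.root_eq
    omega
  have hvr : v ≠ r := by
    rintro rfl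
    have := hd.root_eq
    omega
  obtain ⟨κu, ju, hgu, uniqu⟩ := IH u huP hur (by omega)
  obtain ⟨κv, jv, hgv, uniqv⟩ := IH v hvP hvr (by omega)
  have left : ∀ κ j, Grown P r N u .one (i + 1) → Grown P r N v κ j →
      ((κ = .three ∧ j = i) ∨ (κ = .one ∧ j = i + 1)) →
      ∃ g, (∃ k, Grown P r N q k g) ∧ ∀ k' g', Grown P r N q k' g' → g' = g := by
    intro κ j h1 h2 h3
    obtain ⟨rfl, rfl⟩ := uniqu _ _ h1
    exact grown_only_left hq hur hvP hvq huv hu.symm uniqu h2 h3 hdir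
  have right : ∀ κ j, Grown P r N v .one i → Grown P r N u κ j →
      ((κ = .three ∧ j = i + 1) ∨ (κ = .one ∧ j = i)) →
      ∃ g, (∃ k, Grown P r N q k g) ∧ ∀ k' g', Grown P r N q k' g' → g' = g := by
    intro κ j h1 h2 h3
    obtain ⟨rfl, rfl⟩ := uniqv _ _ h1
    exact grown_only_right hq hvr huP huq hvu hv.symm uniqv h2 h3 hdir
  -- At the root, exactly one of the adjacent neighbours `u` and `v` is in `N`: independence
  -- excludes both, and the alternating choice excludes neither.
  by_cases hwr : w = r
  · subst hwr
    have h0 : i ∈ occupiedDirs P w := by simp [occupiedDirs, hwv, hvP]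
    have h1 : i + 1 ∈ occupiedDirs P w := by simp [occupiedDirs, hwu, huP]
    have g0 := Grown.root (N := N) i (by rwa [hwv])
    have g1 := Grown.root (N := N) (i + 1) (by rwa [hwu])
    rw [hwv] at g0
    rw [hwu] at g1
    by_cases hi : i ∈ N
    · rw [if_pos hi] at g0
      rw [if_neg (hN.2.1 i hi)] at g1
      exact left _ _ g1 g0 (Or.inl ⟨rfl, rfl⟩)
    · rw [if_neg hi] at g0
      rw [if_pos ((hN.2.2.2 i h0 h1).resolve_left hi)] at g1
      exact right _ _ g0 g1 (Or.inl ⟨rfl, rfl⟩)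
  obtain ⟨κ, j, hgw, uniqw⟩ := IH w hwP hwr (by omega)
  have hfw := hgw.fits hd hTI
  have near : ∀ a b c : Dir, Closer P d w a → w + unit a + unit b = w + unit c →
      w + unit c ∈ P → d (w + unit c) ≤ d w := by
    intro a b c h1 h2 h3
    have l := hd.lipschitz _ b h1.1 (by rwa [h2])
    rw [h2] at l
    have := h1.2
    omega
  -- A closer neighbour of `w` is neither `u` nor `v`, nor adjacent to one of them, since that would
  -- put `u` or `v` too close to the root. Hence the cone of `w` points to `u` or to `v`.
  have hno : ∀ h, Closer P d w h → h ≠ i ∧ h ≠ i + 1 ∧ h ≠ i + 2 ∧ h ≠ i + 5 := by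
    intro h hh
    refine ⟨?_, ?_, ?_, ?_⟩ <;> rintro rfl
    · have := hh.2
      rw [hwv] at this
      omega
    · have := hh.2
      rw [hwu] at this
      omega
    · have := near _ i (i + 1) hh (two_steps (by clear * -; revert i; decide) w) (by rwa [hwu])
      rw [hwu] at this
      omega
    · have := near _ (i + 1) i hh (two_steps (by clear * -; revert i; decide) w) (by rwa [hwv])
      rw [hwv] at this
      omega
  have hj := hno _ hfw.1
  have hj' : j = i ∨ j = i + 1 := by
    clear * - hj
    revert i j; decide
  cases κ
  · rcases hj' with rfl | rfl
    · exact left _ _ (hgw.of_hands huP hwu (hands_three.2 (Or.inr ⟨Or.inl rfl, rfl⟩)))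
        (hgw.of_hands hvP hwv (hands_three.2 (Or.inl ⟨rfl, rfl⟩))) (Or.inl ⟨rfl, rfl⟩)
    · refine right _ _ (hgw.of_hands hvP hwv (hands_three.2 (Or.inr ⟨Or.inr ?_, rfl⟩)))
        (hgw.of_hands huP hwu (hands_three.2 (Or.inl ⟨rfl, rfl⟩))) (Or.inl ⟨rfl, rfl⟩)
      clear * -; revert i; decide
  · rcases hj' with rfl | rfl
    · have gv := hgw.of_hands hvP hwv (hands_one.2 (Or.inl ⟨rfl, rfl⟩))
      -- If this node beside `u` is empty, `w` starts a shaft at `u`. Otherwise it is adjacent to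
      -- the parent of `w`, hence closer than `u`. Then `u` has two closer neighbours, which
      -- excludes a 3-cone.
      by_cases hx : w + unit (j + 2) ∈ P
      · have hdx := near _ (j + 1) (j + 2) hfw.1
          (two_steps (by clear * -; revert j; decide) w) hx
        have hux : u + unit (j + 3) = w + unit (j + 2) := by
          rw [← hwu]; exact two_steps (by clear * -; revert j; decide) w
        have hcx : Closer P d u (j + 3) := by
          have := hd.le_succ (g := j + 3) huP (by rwa [hux])
          rw [hux] at this
          rw [Closer, hux]
          exact ⟨hx, by omega⟩
        have hfu := hgu.fits hd hTI
        have hκ : κu = .one := by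
          cases κu
          · have h1 := hfu.2 rfl _ hcx
            have h2 := hfu.2 rfl _ hw
            exact absurd (h1.trans h2.symm) (by clear * -; revert j; decide)
          · rfl
        subst hκ
        have h1 := (hTI u huP).2.cases hcx hfu.1
        have h2 := (hTI u huP).2 _ _ hw hfu.1
        have h3 : ju = j ∨ ju = j + 1 := by
          clear * - h1 h2
          revert j ju; decide
        rcases h3 with rfl | rfl
        · exact right _ _ gv hgu (Or.inr ⟨rfl, rfl⟩)
        · have huw : u + unit (j + 1 + 3) = w := by
            rw [(by decide : ∀ i : Dir, i + 1 + 3 = i + 4) j, hwdef]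
          -- The branch particle `w` can turn towards `u` only with a 3-cone, but `u` has a 1-cone.
          exfalso
          rcases hgu.inversion with ⟨h4, -⟩ | ⟨κ', i', h4, h5⟩ <;> rw [huw] at h4
          · exact hwr h4
          · obtain ⟨rfl, rfl⟩ := uniqw _ _ h4
            rw [huw] at h5
            rcases hands_one.1 h5 with ⟨h6, -⟩ | ⟨h6, -⟩
            · exact absurd h6 (by clear * -; revert i'; decide)
            · cases h6
      · exact right _ _ gv (hgw.of_hands huP hwu (hands_one.2 (Or.inr ⟨rfl, Or.inl ⟨rfl, hx⟩⟩)))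
          (Or.inl ⟨rfl, rfl⟩)
    · have gu := hgw.of_hands huP hwu (hands_one.2 (Or.inl ⟨rfl, rfl⟩))
      have e4 := (by decide : ∀ i : Dir, i + 1 + 4 = i + 5) i
      have e5 := (by decide : ∀ i : Dir, i = i + 1 + 5) i
      by_cases hx : w + unit (i + 5) ∈ P
      · have hdx := near _ i (i + 5) hfw.1
          (two_steps (by clear * -; revert i; decide) w) hx
        have hvx : v + unit (i + 4) = w + unit (i + 5) := by
          rw [← hwv]; exact two_steps (by clear * -; revert i; decide) w
        have hcw : Closer P d v (i + 3) := by
          rw [Closer, hvw]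
          exact ⟨hwP, by omega⟩
        have hcx : Closer P d v (i + 4) := by
          have := hd.le_succ (g := i + 4) hvP (by rwa [hvx])
          rw [hvx] at this
          rw [Closer, hvx]
          exact ⟨hx, by omega⟩
        have hfv := hgv.fits hd hTI
        have hκ : κv = .one := by
          cases κv
          · have h1 := hfv.2 rfl _ hcx
            have h2 := hfv.2 rfl _ hcw
            exact absurd (h1.trans h2.symm) (by clear * -; revert i; decide)
          · rfl
        subst hκ
        have h1 := (hTI v hvP).2.cases hcw hfv.1
        have h2 := (hTI v hvP).2 _ _ hcx hfv.1
        have h3 : jv = i ∨ jv = i + 1 := by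
          clear * - h1 h2
          revert i jv; decide
        rcases h3 with rfl | rfl
        · exfalso
          rcases hgv.inversion with ⟨h4, -⟩ | ⟨κ', i', h4, h5⟩ <;> rw [hvw] at h4
          · exact hwr h4
          · obtain ⟨rfl, rfl⟩ := uniqw _ _ h4
            rw [hvw] at h5
            rcases hands_one.1 h5 with ⟨h6, -⟩ | ⟨h6, -⟩
            · exact absurd h6 (by clear * -; revert jv; decide)
            · cases h6
        · exact left _ _ gu hgv (Or.inr ⟨rfl, rfl⟩)
      · exact left _ _ gu (hgw.of_hands hvP hwv (hands_one.2
          (Or.inr ⟨rfl, Or.inr ⟨e5, by rwa [e4]⟩⟩))) (Or.inl ⟨rfl, rfl⟩)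

/-- The direction determines the parent, and the single cone of the parent then determines the kind.
-/
theorem grown_existsUnique (hd : IsDistanceFrom P r d)
    (hTI : ∀ q ∈ P, TriangleAt P d q ∧ IntervalAt P d q) {N : Finset Dir}
    (hN : IsShaftChoice (occupiedDirs P r) N) (n : ℕ) : UniqueBelow P r N d n := by
  induction n with
  | zero => exact fun p _ _ h => absurd h (Nat.not_lt_zero _)
  | succ n IHn =>
    intro q hq hqr hqn
    have IH : UniqueBelow P r N d (d q) := fun p hp hpr hpq => IHn p hp hpr (by omega)
    have hdir : ∃ g, (∃ k, Grown P r N q k g) ∧ ∀ k' g', Grown P r N q k' g' → g' = g := by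
      obtain ⟨g, hg⟩ := hd.exists_closer q hq hqr
      change Closer P d q g at hg
      have shift : ∀ h : Dir, h + 3 + 3 = h := dir_add_cancel
      by_cases hall : ∀ h, Closer P d q h → h = g
      · exact exists_unique_dir_of_single hd hTI hq IH (i := g + 3) (by rwa [shift])
          (by rwa [shift])
      · push Not at hall
        obtain ⟨h, hh, hne⟩ := hall
        rcases (hTI q hq).2 _ _ hg hh with rfl | rfl | rfl
        · exact absurd rfl hne
        · refine exists_unique_dir_of_double hd hTI hN hq IH (i := g + 3) (by rwa [shift]) ?_
          rwa [(by decide : ∀ g : Dir, g + 3 + 4 = g + 1) g]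
        · refine exists_unique_dir_of_double hd hTI hN hq IH (i := h + 3) (by rwa [shift]) ?_
          rwa [(by decide : ∀ g : Dir, g + 3 + 4 = g + 1) h]
    obtain ⟨g, ⟨k, hk⟩, huniq⟩ := hdir
    refine ⟨k, g, hk, fun k' g' hk' => ?_⟩
    obtain rfl := huniq _ _ hk'
    refine ⟨?_, rfl⟩
    have hc := (hk.fits hd hTI).1
    rcases hk.inversion with ⟨h1, h2⟩ | ⟨κ, i, h1, h2⟩ <;>
    rcases hk'.inversion with ⟨h3, h4⟩ | ⟨κ', i', h3, h4⟩
    · rw [h2, h4]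
    · have := (h3.fits hd hTI).1.2
      rw [h1, hd.root_eq] at this
      omega
    · have := (h1.fits hd hTI).1.2
      rw [h3, hd.root_eq] at this
      omega
    · have hpr : q + unit (g' + 3) ≠ r := by
        intro e
        have := (h1.fits hd hTI).1.2
        rw [e, hd.root_eq] at this
        omega
      obtain ⟨κ₀, i₀, -, hu⟩ := IH _ hc.1 hpr (by have := hc.2; omega)
      obtain ⟨rfl, rfl⟩ := hu _ _ h1
      obtain ⟨rfl, rfl⟩ := hu _ _ h3
      exact h4.kind_unique h2

/-! ### Distances in the graph of the particles -/

theorem triGrid_adj {u v : Node} : triGrid.Adj u v ↔ ∃ g, v = u + unit g := by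
  simp only [triGrid, SimpleGraph.fromRel_adj]
  constructor
  · rintro ⟨-, ⟨g, h⟩ | ⟨g, h⟩⟩
    · exact ⟨g, h⟩
    · exact ⟨g + 3, by rw [h, add_unit_add_three]⟩
  · rintro ⟨g, rfl⟩
    exact ⟨fun h => unit_ne_zero g (left_eq_add.1 h), Or.inl ⟨g, rfl⟩⟩

open Classical in
/-- The distance of a particle from `r` in `G_P`. -/
noncomputable def particleDist (P : Finset Node) (r : (P : Set Node)) (q : Node) : ℕ :=
  if h : q ∈ (P : Set Node) then (occupiedGraph P).dist r ⟨q, h⟩ else 0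

theorem particleDist_coe (r q : (P : Set Node)) :
    particleDist P r q = (occupiedGraph P).dist r q := by
  rw [particleDist, dif_pos q.2]

theorem isDistanceFrom_particleDist (hP : (occupiedGraph P).Connected) (r : (P : Set Node)) :
    IsDistanceFrom P r (particleDist P r) where
  root_mem := r.2
  root_eq := by rw [particleDist_coe, SimpleGraph.dist_self]
  lipschitz q g hq hg := by
    rw [particleDist_coe r ⟨q, hq⟩, particleDist_coe r ⟨q + unit g, hg⟩]
    have hadj : (occupiedGraph P).Adj ⟨q, hq⟩ ⟨q + unit g, hg⟩ := triGrid_adj.2 ⟨g, rfl⟩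
    refine hP.dist_triangle.trans (Nat.add_le_add_left ?_ _)
    exact (SimpleGraph.dist_eq_one_iff_adj.2 hadj).le
  exists_closer q hq hne := by
    obtain ⟨p, hp⟩ := hP.exists_walk_length_eq_dist ⟨q, hq⟩ r
    cases p with
    | nil => exact absurd rfl hne
    | @cons _ v _ h p =>
      obtain ⟨g, hg⟩ := triGrid_adj.1 h
      have hv : particleDist P r v = (occupiedGraph P).dist r v := particleDist_coe r v
      have hq' : particleDist P r q = (occupiedGraph P).dist r ⟨q, hq⟩ := particleDist_coe r ⟨q, hq⟩
      change v.1 = q + unit g at hg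
      refine ⟨g, hg ▸ v.2, ?_⟩
      rw [← hg, hv, hq', SimpleGraph.dist_comm, SimpleGraph.dist_comm (u := r)]
      have h1 := SimpleGraph.dist_le p
      have h2 : (occupiedGraph P).dist ⟨q, hq⟩ r ≤
          (occupiedGraph P).dist ⟨q, hq⟩ v + (occupiedGraph P).dist v r := hP.dist_triangle
      rw [SimpleGraph.dist_eq_one_iff_adj.2 h] at h2
      rw [SimpleGraph.Walk.length_cons] at hp
      omega

/-! ### The labelling -/

open Classical in
/-- The labelling of the particles with the cones that they receive. -/
noncomputable def grownLabelling (P : Finset Node) (r : Node) (N : Finset Dir) : Labelling :=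
  fun q => if h : ∃ x : ConeKind × Dir, Grown P r N q x.1 x.2 then some h.choose else none

theorem grown_of_grownLabelling {N : Finset Dir} {q : Node} {k : ConeKind} {i : Dir}
    (h : grownLabelling P r N q = some (k, i)) : Grown P r N q k i := by
  unfold grownLabelling at h
  split_ifs at h with hx
  have := hx.choose_spec
  rwa [Option.some.inj h] at this

/-- Every particle other than the root receives exactly one cone. -/
structure GrowsUniquely (P : Finset Node) (r : Node) (N : Finset Dir) (d : Node → ℕ) : Prop where
  isDistance : IsDistanceFrom P r d
  fits : ∀ q k i, Grown P r N q k i → Fits P d q k i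
  exists_grown : ∀ q ∈ P, q ≠ r → ∃ k i, Grown P r N q k i
  unique : ∀ q k i k' i', Grown P r N q k i → Grown P r N q k' i' → k' = k ∧ i' = i

theorem growsUniquely (hP : NoHoles (P : Set Node)) (hd : IsDistanceFrom P r d) {N : Finset Dir}
    (hN : IsShaftChoice (occupiedDirs P r) N) : GrowsUniquely P r N d := by
  have hTI : ∀ q ∈ P, TriangleAt P d q ∧ IntervalAt P d q := fun q hq =>
    triangleAt_and_intervalAt hP hd _ q hq le_rfl
  have hu := grown_existsUnique hd hTI hN
  refine ⟨hd, fun q k i h => h.fits hd hTI, fun q hq hne => ?_, fun q k i k' i' h h' => ?_⟩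
  · obtain ⟨k, i, h, -⟩ := hu (d q + 1) q hq hne (Nat.lt_succ_self _)
    exact ⟨k, i, h⟩
  · have hne : q ≠ r := by
      rintro rfl
      have := (h.fits hd hTI).1.2
      rw [hd.root_eq] at this
      omega
    obtain ⟨k₀, i₀, -, h0⟩ := hu (d q + 1) q h.mem hne (Nat.lt_succ_self _)
    obtain ⟨rfl, rfl⟩ := h0 _ _ h
    exact h0 _ _ h'

namespace GrowsUniquely

variable {N : Finset Dir} (H : GrowsUniquely P r N d)
include H

theorem ne_root {q : Node} {k : ConeKind} {i : Dir} (h : Grown P r N q k i) : q ≠ r := by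
  rintro rfl
  have := (H.fits _ _ _ h).1.2
  rw [H.isDistance.root_eq] at this
  omega

theorem grownLabelling_eq_some {q : Node} {k : ConeKind} {i : Dir} :
    grownLabelling P r N q = some (k, i) ↔ Grown P r N q k i := by
  refine ⟨grown_of_grownLabelling, fun h => ?_⟩
  have hx : ∃ x : ConeKind × Dir, Grown P r N q x.1 x.2 := ⟨(k, i), h⟩
  rw [grownLabelling, dif_pos hx]
  obtain ⟨h1, h2⟩ := H.unique _ _ _ _ _ h hx.choose_spec
  exact congrArg some (Prod.ext h1 h2)

theorem grownLabelling_root : grownLabelling P r N r = none := by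
  cases h : grownLabelling P r N r with
  | none => rfl
  | some x => exact absurd rfl (H.ne_root (grown_of_grownLabelling h))

theorem grows_iff {p : Node} {g : Dir} {k : ConeKind} (hp : p ∈ P) :
    Grows P r N (grownLabelling P r N) p g k ↔ Grown P r N (p + unit g) k g := by
  constructor
  · rintro ⟨-, hq, ⟨rfl, rfl⟩ | ⟨-, κ, i, hF, h⟩⟩
    · exact Grown.root g hq
    · exact (grown_of_grownLabelling hF).step hq h
  · intro h
    refine ⟨hp, h.mem, ?_⟩
    have hi := h.inversion
    rw [add_unit_add_three] at hi
    rcases hi with hi | ⟨κ, i, h1, h2⟩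
    · exact Or.inl hi
    · exact Or.inr ⟨H.ne_root h1, κ, i, H.grownLabelling_eq_some.2 h1, h2⟩

theorem existsUnique_dir {q : Node} (hq : q ∈ P) (hne : q ≠ r) :
    ∃! g : Dir, ∃ (p : Node) (k : ConeKind),
      p + unit g = q ∧ Grows P r N (grownLabelling P r N) p g k := by
  obtain ⟨k, i, h⟩ := H.exists_grown q hq hne
  refine ⟨i, ⟨q + unit (i + 3), k, add_unit_three_add _ _, ?_⟩, ?_⟩
  · rw [H.grows_iff (H.fits _ _ _ h).1.1, add_unit_three_add]
    exact h
  · rintro g ⟨p, k', rfl, h'⟩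
    exact (H.unique _ _ _ _ _ h ((H.grows_iff h'.1).1 h')).2

theorem exists_parent {q : Node} (hq : q ∈ P) (hne : q ≠ r) : ∃ (p : Node) (k : ConeKind) (i : Dir),
    grownLabelling P r N q = some (k, i) ∧ p + unit i = q ∧
      Grows P r N (grownLabelling P r N) p i k := by
  obtain ⟨k, i, h⟩ := H.exists_grown q hq hne
  refine ⟨q + unit (i + 3), k, i, H.grownLabelling_eq_some.2 h, add_unit_three_add _ _, ?_⟩
  rw [H.grows_iff (H.fits _ _ _ h).1.1, add_unit_three_add]
  exact h

end GrowsUniquely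

/-! ### The parent edges form a shortest path tree. -/

theorem treeGraph_le (P : Finset Node) (F : Labelling) : treeGraph P F ≤ occupiedGraph P := by
  rintro u v ⟨-, ⟨k, i, -, h⟩ | ⟨k, i, -, h⟩⟩
  · exact SimpleGraph.Adj.symm (G := occupiedGraph P) (triGrid_adj.2 ⟨i, h.symm⟩)
  · exact triGrid_adj.2 ⟨i, h.symm⟩

theorem isSPTree_treeGraph {r : (P : Set Node)} {N : Finset Dir}
    (H : GrowsUniquely P r.1 N (particleDist P r)) :
    IsSPTree P r (treeGraph P (grownLabelling P r.1 N)) := by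
  set F := grownLabelling P r.1 N
  have hle := treeGraph_le P F
  have hpar : ∀ q : (P : Set Node), q ≠ r → ∃ p : (P : Set Node), (treeGraph P F).Adj p q ∧
      particleDist P r p + 1 = particleDist P r q ∧
      ∀ p' : (P : Set Node), (∃ (k : ConeKind) (i : Dir), F q.1 = some (k, i) ∧
        p'.1 + unit i = q.1) → p' = p := by
    intro q hq
    obtain ⟨k, i, h⟩ := H.exists_grown q.1 q.2 (fun e => hq (Subtype.ext e))
    have hc := (H.fits _ _ _ h).1
    have hF := H.grownLabelling_eq_some.2 h
    refine ⟨⟨q.1 + unit (i + 3), hc.1⟩, ⟨?_, Or.inr ⟨k, i, hF, add_unit_three_add _ _⟩⟩, hc.2, ?_⟩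
    · intro e
      exact unit_ne_zero _ (add_eq_left.1 (congrArg Subtype.val e))
    · rintro p' ⟨k', i', hF', e⟩
      obtain ⟨-, rfl⟩ := Prod.mk.inj (Option.some.inj (hF.symm.trans hF'))
      refine Subtype.ext ?_
      change p'.1 = q.1 + unit (i + 3)
      rw [← e, add_unit_add_three]
  have hreach : ∀ n, ∀ q : (P : Set Node), particleDist P r q = n →
      ∃ p : (treeGraph P F).Walk r q, p.length = n := by
    intro n
    induction n with
    | zero =>
      intro q hq
      obtain rfl : q = r := Subtype.ext (H.isDistance.eq_root q.2 hq)
      exact ⟨.nil, rfl⟩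
    | succ n ih =>
      intro q hq
      have hne : q ≠ r := by
        rintro rfl
        rw [H.isDistance.root_eq] at hq
        omega
      obtain ⟨p, hadj, hdp, -⟩ := hpar q hne
      obtain ⟨w, hw⟩ := ih p (by omega)
      exact ⟨w.concat hadj, by rw [SimpleGraph.Walk.length_concat, hw]⟩
  have hconn : (treeGraph P F).Connected := by
    have : Nonempty (P : Set Node) := ⟨r⟩
    refine ⟨fun u v => ?_⟩
    obtain ⟨w, -⟩ := hreach _ u rfl
    obtain ⟨w', -⟩ := hreach _ v rfl
    exact ⟨w.reverse.append w'⟩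
  refine ⟨hle, ?_, fun q => le_antisymm ?_ ?_⟩
  · rw [SimpleGraph.isTree_iff_connected_and_card]
    -- Each edge joins a particle other than the root to its parent, so there are at most as many
    -- edges as such particles. Connectedness gives the converse bound.
    refine ⟨hconn, le_antisymm ?_ hconn.card_vert_le_card_edgeSet_add_one⟩
    classical
    choose! par hpar using hpar
    have hsub : (treeGraph P F).edgeSet ⊆ (fun q => s(par q, q)) '' {q | q ≠ r} := by
      intro e
      induction e with
      | _ u v =>
        intro he
        have hroot : ∀ u : (P : Set Node), ∀ k i, F u.1 = some (k, i) → u ≠ r := by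
          rintro u k i hF rfl
          exact H.ne_root (grown_of_grownLabelling hF) rfl
        rcases he.2 with ⟨k, i, hF, h⟩ | ⟨k, i, hF, h⟩
        · have hne := hroot u k i hF
          refine ⟨u, hne, ?_⟩
          rw [(hpar u hne).2.2 v ⟨k, i, hF, h⟩, Sym2.eq_swap]
        · have hne := hroot v k i hF
          refine ⟨v, hne, ?_⟩
          rw [(hpar v hne).2.2 u ⟨k, i, hF, h⟩]
    have hcard : ({q | q ≠ r} : Set (P : Set Node)).ncard + 1 = Nat.card (P : Set Node) := by
      have := Set.ncard_add_ncard_compl ({r} : Set (P : Set Node))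
      rw [Set.ncard_singleton] at this
      rw [← this, add_comm]
      rfl
    rw [← hcard, Nat.card_coe_set_eq]
    exact Nat.add_le_add_right ((Set.ncard_le_ncard hsub (Set.toFinite _)).trans
      (Set.ncard_image_le (Set.toFinite _))) 1
  · obtain ⟨w, hw⟩ := hreach _ q rfl
    rw [← particleDist_coe, ← hw]
    exact SimpleGraph.dist_le w
  · exact SimpleGraph.Reachable.dist_anti hle (hconn.preconnected r q)

theorem isFeatherTree_grownLabelling {r : (P : Set Node)}
    {N : Finset Dir} (H : GrowsUniquely P r.1 N (particleDist P r)) :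
    IsFeatherTree P r N (grownLabelling P r.1 N) :=
  ⟨H.grownLabelling_root, fun _ hq hne => H.exists_parent hq hne, isSPTree_treeGraph H⟩

/-! ### Frames -/

theorem Frame.dir_injective (fr : Frame) (p : Node) : Function.Injective (fr.dir p) := by
  intro j k h
  unfold Frame.dir at h
  split_ifs at h
  · exact neg_injective (add_left_cancel h)
  · exact add_left_cancel h

theorem Frame.dir_surjective (fr : Frame) (p : Node) : Function.Surjective (fr.dir p) :=
  Finite.surjective_of_injective (fr.dir_injective p)

theorem Frame.dir_add_three (fr : Frame) (p : Node) (j : Port) :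
    fr.dir p (j + 3) = fr.dir p j + 3 := by
  unfold Frame.dir
  split_ifs
  · rw [neg_add, ← add_assoc, (by decide : -(3 : ZMod 6) = 3)]
  · rw [add_assoc]

theorem Frame.dir_add (fr : Frame) (p : Node) (i j : Port) :
    fr.dir p (i + j) = if fr.mirrored p then fr.dir p i - j else fr.dir p i + j := by
  unfold Frame.dir
  split_ifs <;> ring

theorem Frame.dir_sub (fr : Frame) (p : Node) (i j : Port) :
    fr.dir p (i - j) = if fr.mirrored p then fr.dir p i + j else fr.dir p i - j := by
  unfold Frame.dir
  split_ifs <;> ring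

theorem Frame.dir_mem_cone (fr : Frame) (p : Node) (κ : ConeKind) (i k : Port) :
    fr.dir p k ∈ cone κ (fr.dir p i) ↔ k ∈ cone κ i := by
  have hinj : ∀ {b}, fr.dir p k = fr.dir p b ↔ k = b := (fr.dir_injective p).eq_iff
  cases κ
  · simp only [cone, Finset.mem_insert, Finset.mem_singleton]
    rw [← hinj (b := i - 1), ← hinj (b := i), ← hinj (b := i + 1), fr.dir_add, fr.dir_sub]
    split_ifs <;> tauto
  · simp only [cone, Finset.mem_singleton]
    exact hinj

/-- What the particle at `p` sees of the memories of its neighbours. -/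
def memoryView (P : Finset Node) (fr : Frame) (c : Node → FeatherMem) (p : Node) :
    Port → Option FeatherMem :=
  fun k => if p + unit (fr.dir p k) ∈ P then some (c (p + unit (fr.dir p k))) else none

theorem featherAlgorithm_sends_iff {χ : ShaftRule} {P : Finset Node} {fr : Frame}
    {c : Node → FeatherMem} {p q : Node} {j : Port} {x : ConeKind} :
    (featherAlgorithm χ).Sends P fr c p q j x ↔ ∃ k : Port, p + unit (fr.dir p k) = q ∧
      q + unit (fr.dir q j) = p ∧ memoryView P fr c p k = some .idle ∧
      offer χ (c p) (memoryView P fr c p) k = some x := by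
  have h : ∀ k, ((featherAlgorithm χ).act (c p) ((featherAlgorithm χ).view P fr c p)).2 k =
      if memoryView P fr c p k = some .idle then offer χ (c p) (memoryView P fr c p) k
      else none := fun _ => rfl
  refine exists_congr fun k => and_congr_right fun _ => and_congr_right fun _ => ?_
  rw [h]
  split_ifs with hi
  · exact (and_iff_right hi).symm
  · exact ⟨fun h => absurd h (by simp), fun h => absurd h.1 hi⟩

/-- Up to the frame of the particle, offers follow the growth rule. -/
theorem offer_member_eq_some_iff (χ : ShaftRule) (P : Finset Node) (fr : Frame)
    (c : Node → FeatherMem) (p : Node) (κ x : ConeKind) (j k : Port) :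
    offer χ (.member κ j) (memoryView P fr c p) k = some x ↔
      Hands P p κ (fr.dir p j + 3) (fr.dir p k) x := by
  have hview : ∀ l : Port, memoryView P fr c p l = none ↔
      p + unit (fr.dir p l) ∉ P := by
    intro l
    simp [memoryView]
  have hinj : ∀ {b}, fr.dir p k = fr.dir p b ↔ k = b := (fr.dir_injective p).eq_iff
  have hnew : ((k = (j + 3) + 1 ∧ memoryView P fr c p ((j + 3) + 2) = none) ∨
      (k = (j + 3) - 1 ∧ memoryView P fr c p ((j + 3) - 2) = none)) ↔
      ((fr.dir p k = fr.dir p j + 3 + 1 ∧ p + unit (fr.dir p j + 3 + 2) ∉ P) ∨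
        (fr.dir p k = fr.dir p j + 3 - 1 ∧ p + unit (fr.dir p j + 3 - 2) ∉ P)) := by
    rw [hview, hview, ← hinj (b := j + 3 + 1), ← hinj (b := j + 3 - 1), fr.dir_add _ (j + 3),
      fr.dir_add _ (j + 3), fr.dir_sub, fr.dir_sub, fr.dir_add_three]
    -- A mirrored frame exchanges the two sides of a branch, and the rule for new shafts is
    -- symmetric under this exchange.
    split_ifs
    · exact or_comm
    · exact Iff.rfl
  have hcone : k ∈ cone κ (j + 3) ↔ fr.dir p k ∈ cone κ (fr.dir p j + 3) := by
    rw [← fr.dir_add_three, fr.dir_mem_cone]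
  have heq : k = j + 3 ↔ fr.dir p k = fr.dir p j + 3 := by
    rw [← fr.dir_add_three, hinj]
  unfold offer
  simp only [hnew, hcone, heq]
  generalize fr.dir p k = g
  generalize fr.dir p j + 3 = i
  have e1 := (by decide : ∀ i : Dir, i + 1 ≠ i) i
  have e5 := (by decide : ∀ i : Dir, i - 1 ≠ i) i
  cases κ
  · simp only [Hands, reduceCtorEq, false_and, or_false, if_false]
    split_ifs <;> simp_all [eq_comm]
  · simp only [Hands, cone, Finset.mem_singleton, true_and]
    split_ifs <;> simp_all [eq_comm]

theorem mem_chosenShafts_iff {P : Finset Node} {r : Node} {fr : Frame} {χ : ShaftRule}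
    {c : Node → FeatherMem} {k : Port} :
    k ∈ χ.choose (Finset.univ.filter
      (fun k => (memoryView P fr c r k).isSome)) ↔
      fr.dir r k ∈ chosenShafts P r fr χ := by
  have h : (Finset.univ.filter (fun k => (memoryView P fr c r k).isSome)) =
      Finset.univ.filter (fun k => r + unit (fr.dir r k) ∈ P) := by
    ext k
    by_cases h : r + unit (fr.dir r k) ∈ P <;> simp [memoryView, h]
  rw [chosenShafts, h, Finset.mem_image]
  constructor
  · exact fun hk => ⟨k, hk, rfl⟩
  · rintro ⟨l, hl, e⟩
    rwa [← fr.dir_injective _ e]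

/-! ### Executions -/

/-- The particles of the tree store the cones of the feather tree. -/
structure IsPartialTree (P : Finset Node) (r : Node) (N : Finset Dir) (fr : Frame)
    (c : Node → FeatherMem) : Prop where
  root : c r = .root
  other : ∀ q ∈ P, q ≠ r → c q = .idle ∨
    ∃ k j, c q = .member k j ∧ Grown P r N q k (fr.dir q j + 3)

theorem isPartialTree_initialMem (P : Finset Node) (r : Node) (N : Finset Dir) (fr : Frame) :
    IsPartialTree P r N fr (initialMem r) where
  root := if_pos rfl
  other _ _ hne := Or.inl (if_neg hne)

section Step

variable {N : Finset Dir} {fr : Frame} {χ : ShaftRule} {c c' : Node → FeatherMem} {A : Set Node}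

/-- The invariant makes every message legitimate: senders hold cones of the growth rule, and the
receiving port is opposite to the direction of growth. Conflicts are harmless because all messages
to `q` carry the same cone once uniqueness is known. -/
theorem grown_of_sends (hχ : chosenShafts P r fr χ = N) (hc : IsPartialTree P r N fr c)
    {p q : Node} (hp : p ∈ P) (hq : q ∈ P) {j : Port} {x : ConeKind}
    (h : (featherAlgorithm χ).Sends P fr c p q j x) : Grown P r N q x (fr.dir q j + 3) := by
  obtain ⟨k, rfl, hj, -, hx⟩ := featherAlgorithm_sends_iff.1 h
  have hdir : fr.dir (p + unit (fr.dir p k)) j + 3 = fr.dir p k := by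
    rw [add_assoc, add_eq_left, add_comm] at hj
    have h1 := (eq_neg_of_add_eq_zero_left hj).trans (unit_add_three _).symm
    rw [unit_injective h1, dir_add_cancel]
  rw [hdir]
  by_cases hpr : p = r
  · subst hpr
    have hg := Grown.root (N := N) _ hq
    rw [hc.root] at hx
    simp only [offer] at hx
    simp only [mem_chosenShafts_iff, hχ] at hx
    split_ifs at hx hg with hN
    · rwa [← Option.some.inj hx]
    · rwa [← Option.some.inj hx]
  · rcases hc.other p hp hpr with h0 | ⟨κ, l, h0, hg⟩
    · rw [h0] at hx
      exact absurd hx (by simp [offer])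
    · rw [h0, offer_member_eq_some_iff] at hx
      exact hg.step hq hx

theorem IsPartialTree.next (hχ : chosenShafts P r fr χ = N) (hc : IsPartialTree P r N fr c)
    (hr : r ∈ P) (hs : (featherAlgorithm χ).Step P fr A c c') : IsPartialTree P r N fr c' ∧
      ∀ q ∈ P, c q ≠ .idle → c' q = c q := by
  have hstep : ∀ q ∈ P, c' q = c q ∨ c q = .idle ∧
      ∃ j x, c' q = .member x j ∧ Grown P r N q x (fr.dir q j + 3) := by
    intro q hq
    obtain ⟨m, hm1, hm2, hm⟩ := hs q hq
    -- An activation leaves the own memory unchanged; only messages alter it.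
    have hmq : m = c q := by
      by_cases hA : q ∈ A
      · exact hm1 hA
      · exact hm2 hA
    subst hmq
    rcases hm with ⟨-, h⟩ | ⟨p, hp, -, j, x, hsend, h⟩
    · exact Or.inl h
    · change c' q = if c q = .idle then .member x j else c q at h
      split_ifs at h with hi
      · exact Or.inr ⟨hi, j, x, h, grown_of_sends hχ hc hp hq hsend⟩
      · exact Or.inl h
  refine ⟨⟨?_, fun q hq hne => ?_⟩, fun q hq hne => ?_⟩
  · rcases hstep r hr with h | ⟨h, -⟩
    · rw [h, hc.root]
    · rw [hc.root] at h
      cases h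
  · rcases hstep q hq with h | ⟨-, j, x, h⟩
    · rw [h]
      exact hc.other q hq hne
    · exact Or.inr ⟨x, j, h⟩
  · rcases hstep q hq with h | ⟨h, -⟩
    · exact h
    · exact absurd h hne

theorem exists_sends (H : GrowsUniquely P r N d) (hc : IsPartialTree P r N fr c)
    {p q : Node} {k : ConeKind} {g : Dir} (hp : p ∈ P) (hpq : p + unit g = q)
    (hq : Grown P r N q k g) (hpi : c p ≠ .idle) (hqi : c q = .idle) :
    ∃ j x, (featherAlgorithm χ).Sends P fr c p q j x := by
  obtain ⟨l, rfl⟩ := fr.dir_surjective p g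
  obtain ⟨j, hj⟩ := fr.dir_surjective q (fr.dir p l + 3)
  have hview : memoryView P fr c p l = some .idle := by
    unfold memoryView
    rw [if_pos (by rw [hpq]; exact hq.mem), hpq, hqi]
  have hoffer : ∃ x, offer χ (c p) (memoryView P fr c p) l = some x := by
    have hi := hq.inversion
    rw [← hpq, add_unit_add_three] at hi
    by_cases hpr : p = r
    · rw [hpr, hc.root]
      simp only [offer]
      split_ifs
      exacts [⟨_, rfl⟩, ⟨_, rfl⟩]
    · rcases hi with ⟨h, -⟩ | ⟨κ, i, h1, h2⟩
      · exact absurd h hpr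
      · rcases hc.other p hp hpr with h0 | ⟨κ', l', h0, hg⟩
        · exact absurd h0 hpi
        · obtain ⟨rfl, rfl⟩ := H.unique _ _ _ _ _ hg h1
          exact ⟨k, by rw [h0, offer_member_eq_some_iff]; exact h2⟩
  obtain ⟨x, hx⟩ := hoffer
  exact ⟨j, x, featherAlgorithm_sends_iff.2
    ⟨l, hpq, by rw [hj, ← hpq, add_unit_add_three], hview, hx⟩⟩

/-- The message of `p` itself need not succeed: any message that does also includes `q` into the
tree. -/
theorem not_idle_of_step (H : GrowsUniquely P r N d) (hχ : chosenShafts P r fr χ = N)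
    (hc : IsPartialTree P r N fr c) (hs : (featherAlgorithm χ).Step P fr A c c')
    {p q : Node} {k : ConeKind} {g : Dir} (hp : p ∈ P) (hpq : p + unit g = q)
    (hq : Grown P r N q k g) (hpi : c p ≠ .idle) (hA : p ∈ A) : c' q ≠ .idle := by
  by_cases hqi : c q = .idle
  · obtain ⟨j, x, hsend⟩ := exists_sends (χ := χ) H hc hp hpq hq hpi hqi
    obtain ⟨m, hm1, hm2, hm⟩ := hs q hq.mem
    have hmq : m = c q := by
      by_cases hA : q ∈ A
      · exact hm1 hA
      · exact hm2 hA
    subst hmq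
    rcases hm with ⟨h, -⟩ | ⟨p', hp', -, j', x', hsend', h⟩
    · exact absurd hsend (h p hp hA j x)
    · change c' q = if c q = .idle then .member x' j' else c q at h
      rw [if_pos hqi] at h
      rw [h]
      exact fun h => by cases h
  · rw [(hc.next hχ H.isDistance.root_mem hs).2 q hq.mem hqi]
    exact hqi

end Step

theorem exists_isRoundEnd {A : ℕ → Set Node} (hA : Fair P A) (k : ℕ) :
    ∃ T, IsRoundEnd P A k T := by
  classical
  induction k with
  | zero => exact ⟨0, rfl⟩
  | succ k ih =>
    obtain ⟨S, hS⟩ := ih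
    choose! u hu using fun p (hp : p ∈ P) => hA p hp S
    have hne : ∃ T', S ≤ T' ∧ ∀ p ∈ P, ∃ u, S ≤ u ∧ u < T' ∧ p ∈ A u := by
      refine ⟨max S (P.sup u + 1), le_max_left _ _, fun p hp => ⟨u p, (hu p hp).1, ?_, (hu p hp).2⟩⟩
      exact lt_of_lt_of_le (Nat.lt_succ_of_le (Finset.le_sup hp)) (le_max_right _ _)
    exact ⟨Nat.find hne, S, hS, Nat.find_spec hne, fun T hT => Nat.find_min' hne hT⟩

section Execution

variable {N : Finset Dir} {fr : Frame} {χ : ShaftRule} {A : ℕ → Set Node}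
  {c : ℕ → Node → FeatherMem}

theorem isPartialTree_of_isExecution (hχ : chosenShafts P r fr χ = N) (hr : r ∈ P)
    (hc : (featherAlgorithm χ).IsExecution P fr A (initialMem r) c) (t : ℕ) :
    IsPartialTree P r N fr (c t) := by
  induction t with
  | zero =>
    rw [hc.1]
    exact isPartialTree_initialMem P r N fr
  | succ t ih => exact (ih.next hχ hr (hc.2 t)).1

theorem not_idle_of_le (hχ : chosenShafts P r fr χ = N) (hr : r ∈ P)
    (hc : (featherAlgorithm χ).IsExecution P fr A (initialMem r) c) {q : Node} (hq : q ∈ P)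
    {s t : ℕ} (hst : s ≤ t) (hs : c s q ≠ .idle) : c t q ≠ .idle := by
  induction t, hst using Nat.le_induction with
  | base => exact hs
  | succ t _ ih =>
    rw [((isPartialTree_of_isExecution hχ hr hc t).next hχ hr (hc.2 t)).2 q hq ih]
    exact ih

/-- After `k` rounds, the tree contains all particles at distance at most `k` from the root. -/
theorem not_idle_of_isRoundEnd (H : GrowsUniquely P r N d) (hχ : chosenShafts P r fr χ = N)
    (hc : (featherAlgorithm χ).IsExecution P fr A (initialMem r) c) (k : ℕ) :
    ∀ T, IsRoundEnd P A k T → ∀ q ∈ P, d q ≤ k → c T q ≠ .idle := by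
  have hr := H.isDistance.root_mem
  have hroot : ∀ t, c t r ≠ .idle := fun t h => by
    rw [(isPartialTree_of_isExecution hχ hr hc t).root] at h
    cases h
  induction k with
  | zero =>
    intro T _ q hq hd
    rw [H.isDistance.eq_root hq (by omega)]
    exact hroot T
  | succ k ih =>
    rintro T ⟨S, hS, hT, -⟩ q hq hd
    by_cases hqr : q = r
    · rw [hqr]
      exact hroot T
    obtain ⟨κ, i, hg⟩ := H.exists_grown q hq hqr
    have hcl := (H.fits _ _ _ hg).1
    obtain ⟨u, hSu, huT, hA⟩ := hT.2 _ hcl.1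
    -- The parent is one level closer, so it is in the tree when the round begins, and it is
    -- activated during the round.
    have hp := not_idle_of_le hχ hr hc hcl.1 hSu (ih S hS _ hcl.1 (by have := hcl.2; omega))
    exact not_idle_of_le hχ hr hc hq huT
      (not_idle_of_step H hχ (isPartialTree_of_isExecution hχ hr hc u) (hc.2 u) hcl.1
        (add_unit_three_add _ _) hg hp hA)

theorem storedLabelling_eq (H : GrowsUniquely P r N d) {c : Node → FeatherMem}
    (hc : IsPartialTree P r N fr c) {q : Node} (hq : q ∈ P) (hi : c q ≠ .idle) :
    storedLabelling fr c q = grownLabelling P r N q := by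
  by_cases hqr : q = r
  · rw [hqr, H.grownLabelling_root, storedLabelling, hc.root]
  · rcases hc.other q hq hqr with h | ⟨k, j, h, hg⟩
    · exact absurd h hi
    · rw [H.grownLabelling_eq_some.2 hg, storedLabelling, h]

end Execution

theorem mainTheorem5 :
    ∃ C : ℕ, ∀ (P : Finset Node), SimplyConnected P → ∀ (r : (P : Set Node)) (N : Finset Dir),
      IsShaftChoice (occupiedDirs P r.1) N →
      ∃ F : Labelling,
        IsFeatherTree P r N F ∧
        (∀ q ∈ P, q ≠ r.1 → ∃! g : Dir, ∃ (p : Node) (k : ConeKind),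
          p + unit g = q ∧ Grows P r.1 N F p g k) ∧
        ∀ (fr : Frame) (χ : ShaftRule), chosenShafts P r.1 fr χ = N →
          ∀ A : ℕ → Set Node, Fair P A →
          ∀ c : ℕ → Node → FeatherMem,
            (featherAlgorithm χ).IsExecution P fr A (initialMem r.1) c →
            ∃ T : ℕ, IsRoundEnd P A (C * (occupiedGraph P).diam) T ∧
              ∀ t ≥ T, ∀ q ∈ P, storedLabelling fr (c t) q = F q := by
  -- One round per level suffices, and no distance from the root exceeds the diameter.
  refine ⟨1, fun P hP r N hN => ?_⟩
  have H := growsUniquely (noHoles_of_simplyConnected hP)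
    (isDistanceFrom_particleDist hP.1 r) hN
  refine ⟨grownLabelling P r N, isFeatherTree_grownLabelling H,
    fun q hq hne => H.existsUnique_dir hq hne, fun fr χ hχ A hA c hc => ?_⟩
  rw [one_mul]
  obtain ⟨T, hT⟩ := exists_isRoundEnd hA (occupiedGraph P).diam
  have : Nonempty (P : Set Node) := ⟨r⟩
  refine ⟨T, hT, fun t ht q hq => ?_⟩
  refine storedLabelling_eq H (isPartialTree_of_isExecution hχ r.2 hc t) hq ?_
  refine not_idle_of_le hχ r.2 hc hq ht (not_idle_of_isRoundEnd H hχ hc _ T hT q hq ?_)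
  rw [particleDist_coe r ⟨q, hq⟩]
  exact SimpleGraph.dist_le_diam (SimpleGraph.connected_iff_ediam_ne_top.1 hP.1)
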